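/- Let $L$ be a compact connected (Hausdorff) affine manifold of dimension $n$, that is, a manifold with an atlas modelled on $\mathbb R^n$ whose coordinate changes are locally affine, and let $\nabla$ be its flat torsion-free connection. Suppose that the linear holonomy of $L$ is contained in $GL(n,\mathbb Z)$: there are a point $x_0\in L$ and a basis $b$ of $T_{x_0}L$ in which the parallel transport along every loop at $x_0$ has a matrix in $GL(n,\mathbb Z)$. Then $(L,\nabla)$ is a leaf of a lagrangian foliation on a compact symplectic manifold: there are a compact Hausdorff smooth manifold $M$ of dimension $2n$, a symplectic form $\omega$ on $M$, a smooth foliation $\mathcal F$ of $M$ with $T\mathcal F=(T\mathcal F)^{\perp_\omega}$, and an injective immersion $\iota\colon L\to M$, tangent to $\mathcal F$, whose image is a leaf of $\mathcal F$, such that $\nabla$ is the Weinstein connection of this leaf, i.e. the connection determined by $$\omega(\nabla_XY,Z)=X\cdot\omega(Y,Z)-\omega(Y,[X,Z])$$ for vector fields $X,Y$ tangent to $\mathcal F$ and arbitrary $Z$. Moreover, $M$ can be taken to be the torus bundle over $L$ obtained from $T^*L$ by dividing each fibre $T_x^*L$ by the lattice $\Lambda_x\cong\mathbb Z^n$ of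 the covectors that have integral values on the parallel transports of the vectors of $b$ to $x$. More precisely, there is a surjective local diffeomorphism $q\colon T^*L\to M$ with $q(x,\alpha)=q(y,\beta)$ if and only if $x=y$ and $\alpha-\beta\in\Lambda_x$, such that $\iota(x)=q(x,0)$ and such that, in the coordinates $(x,p)$ of $T^*L$ that belong to affine coordinates $x$ of $L$, $q^*\omega=\sum_i dx_i\wedge dp_i$ and $q^*\mathcal F$ is the foliation $dp_1=\dots=dp_n=0$. -/

import Mathlib

open Set Filter Topology Manifold Bundle
open scoped ContDiff

universe u v

noncomputable section

namespace LagrangianLeaf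

/-! ### Affine manifolds -/

section Affine

variable (E : Type v) [NormedAddCommGroup E] [NormedSpace ℝ E]

/-- Maps that are affine near every point of a given set. -/
def affinePregroupoid : Pregroupoid E where
  property f s := ∀ x ∈ s, ∃ A : E →ᴬ[ℝ] E, f =ᶠ[𝓝[s] x] A
  comp {f g u v} hf hg hu hv huv := by
    rintro x ⟨hxu, hxv⟩
    obtain ⟨A, hA⟩ := hf x hxu
    obtain ⟨B, hB⟩ := hg (f x) hxv
    rw [hu.nhdsWithin_eq hxu] at hA
    rw [hv.nhdsWithin_eq hxv] at hB
    have hc : Tendsto f (𝓝 x) (𝓝 (f x)) := by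
      have h1 : Tendsto A (𝓝 x) (𝓝 (A x)) := A.continuous.tendsto x
      rw [← hA.eq_of_nhds] at h1
      exact h1.congr' hA.symm
    refine ⟨B.comp A, Filter.Eventually.filter_mono nhdsWithin_le_nhds ?_⟩
    filter_upwards [hA, hc.eventually hB] with y h1 h2
    rw [Function.comp_apply, h2, h1]
    rfl
  id_mem := fun x _ => ⟨ContinuousAffineMap.id ℝ E, Eventually.of_forall fun _ => rfl⟩
  locality {f u} hu h := by
    intro x hx
    obtain ⟨v, hv, hxv, hf⟩ := h x hx
    obtain ⟨A, hA⟩ := hf x ⟨hx, hxv⟩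
    refine ⟨A, ?_⟩
    rw [(hu.inter hv).nhdsWithin_eq ⟨hx, hxv⟩] at hA
    rwa [hu.nhdsWithin_eq hx]
  congr {f g u} _ h hf := by
    intro x hx
    obtain ⟨A, hA⟩ := hf x hx
    refine ⟨A, ?_⟩
    filter_upwards [hA, self_mem_nhdsWithin] with y h1 h2
    rw [h y h2, h1]

/-- The groupoid of locally affine local homeomorphisms of `E`.  An affine manifold is a manifold
`L` modelled on `E` with `HasGroupoid L (affineGroupoid E)`: its coordinate changes are locally
affine maps. -/
def affineGroupoid : StructureGroupoid E := (affinePregroupoid E).groupoid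

theorem affineGroupoid_le_contDiffGroupoid :
    affineGroupoid E ≤ contDiffGroupoid ∞ 𝓘(ℝ, E) := by
  refine groupoid_of_pregroupoid_le _ _ ?_
  intro f s hf x hx
  have hx' : x ∈ s := hx.1
  obtain ⟨A, hA⟩ := hf x hx'
  have hs : (𝓘(ℝ, E).symm ⁻¹' s ∩ range 𝓘(ℝ, E) : Set E) = s := by simp
  have hA' : f =ᶠ[𝓝[s] x] A := hA
  rw [hs]
  exact (A.contDiff (n := ∞)).contDiffWithinAt.congr_of_eventuallyEq hA'
    (hA'.eq_of_nhdsWithin hx')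

variable {E} {L : Type u} [TopologicalSpace L] [ChartedSpace E L]

instance isManifold_of_affine [h : HasGroupoid L (affineGroupoid E)] :
    IsManifold 𝓘(ℝ, E) ∞ L :=
  { hasGroupoid_of_le h (affineGroupoid_le_contDiffGroupoid E) with }

variable (E)

/-- The flat connection `∇_v η` of an affine manifold, at the point `x`: the derivative of the
coordinate expression of `η` in an affine chart around `x`. -/
def flatConnection (η : ∀ x : L, TangentSpace 𝓘(ℝ, E) x) (x : L) (v : TangentSpace 𝓘(ℝ, E) x) :
    TangentSpace 𝓘(ℝ, E) x :=
  (mvfderiv 𝓘(ℝ, E) (extChartAt 𝓘(ℝ, E) x) x).inverse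
    (mvfderiv 𝓘(ℝ, E) (fun y => mvfderiv 𝓘(ℝ, E) (extChartAt 𝓘(ℝ, E) x) y (η y)) x v)

variable {E}

/-- `w` is the parallel transport of `v` along the path `γ`, for the flat connection of an affine
manifold: there is a vector field along `γ` from `v` to `w` whose coordinates in affine charts are
locally constant. -/
def IsParallelTransport {x y : L} (γ : Path x y) (v : TangentSpace 𝓘(ℝ, E) x)
    (w : TangentSpace 𝓘(ℝ, E) y) : Prop :=
  ∃ V : unitInterval → TangentBundle 𝓘(ℝ, E) L,
    (∀ t, (V t).proj = γ t) ∧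
    (∀ t₀, ∀ᶠ t in 𝓝 t₀,
      mvfderiv 𝓘(ℝ, E) (extChartAt 𝓘(ℝ, E) (V t₀).proj) (V t).proj (V t).snd =
        mvfderiv 𝓘(ℝ, E) (extChartAt 𝓘(ℝ, E) (V t₀).proj) (V t₀).proj (V t₀).snd) ∧
    V 0 = ⟨x, v⟩ ∧ V 1 = ⟨y, w⟩

variable (E) in
/-- The linear holonomy of an affine manifold at `x₀`: all parallel transports along loops. -/
def linearHolonomy (x₀ : L) : Set (TangentSpace 𝓘(ℝ, E) x₀ ≃ₗ[ℝ] TangentSpace 𝓘(ℝ, E) x₀) :=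
  {A | ∃ γ : Path x₀ x₀, ∀ v, IsParallelTransport γ v (A v)}

/-- In the basis `b` of the tangent space at `x₀`, the linear holonomy is contained in
`GL(n, ℤ)`. -/
def HasIntegralLinearHolonomy {n : ℕ} {x₀ : L}
    (b : Module.Basis (Fin n) ℝ (TangentSpace 𝓘(ℝ, E) x₀)) : Prop :=
  ∀ A ∈ linearHolonomy E x₀, ∃ B : GL (Fin n) ℤ,
    LinearMap.toMatrix b b A.toLinearMap = (B : Matrix (Fin n) (Fin n) ℤ).map (Int.cast : ℤ → ℝ)

/-- The lattice in the cotangent space at `x` that consists of the covectors with integral values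
on the parallel transports of `b` to `x`.  At `x₀` it is spanned by the dual basis of `b` if the
holonomy is integral in `b`. -/
def cotangentLattice {n : ℕ} {x₀ : L} (b : Module.Basis (Fin n) ℝ (TangentSpace 𝓘(ℝ, E) x₀))
    (x : L) : Set (TangentSpace 𝓘(ℝ, E) x →L[ℝ] ℝ) :=
  {α | ∀ (γ : Path x₀ x) (i : Fin n) (w : TangentSpace 𝓘(ℝ, E) x),
    IsParallelTransport γ (b i) w → ∃ k : ℤ, α w = k}

variable (E L) in
/-- The cotangent bundle of `L`, with Mathlib's manifold structure: its charts are the natural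
coordinates `(x, p)` that belong to the charts `x` of `L`. -/
abbrev CotangentBundle : Type (max u v) :=
  TotalSpace (E →L[ℝ] ℝ) (fun x : L => TangentSpace 𝓘(ℝ, E) x →L[ℝ] ℝ)

end Affine

/-! ### Differential forms, symplectic manifolds, foliations -/

section Forms

variable {F : Type*} [NormedAddCommGroup F] [NormedSpace ℝ F] {H : Type*} [TopologicalSpace H]
  (I : ModelWithCorners ℝ F H) {M : Type*} [TopologicalSpace M] [ChartedSpace H M]

variable (M) in
/-- (Not necessarily continuous) differential `2`-forms on `M`. -/
abbrev TwoForm := ∀ m : M, TangentSpace I m [⋀^Fin 2]→L[ℝ] ℝ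

/-- The coordinate expression of a `2`-form in the chart at `m₀`. -/
def TwoForm.inChart (σ : TwoForm I M) (m₀ : M) (y : F) : F [⋀^Fin 2]→L[ℝ] ℝ :=
  (σ ((extChartAt I m₀).symm y)).compContinuousLinearMap
    (mfderiv 𝓘(ℝ, F) I (extChartAt I m₀).symm y)

/-- The pull-back of a `2`-form by a map. -/
def TwoForm.pullback {F' : Type*} [NormedAddCommGroup F'] [NormedSpace ℝ F'] {H' : Type*}
    [TopologicalSpace H'] (J : ModelWithCorners ℝ F' H') {N : Type*} [TopologicalSpace N]
    [ChartedSpace H' N] (q : N → M) (σ : TwoForm I M) : TwoForm J N :=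
  fun z => (σ (q z)).compContinuousLinearMap (mfderiv J I q z)

end Forms

section Foliations

variable {F : Type*} [NormedAddCommGroup F] [NormedSpace ℝ F]
  {M : Type*} [TopologicalSpace M] [ChartedSpace F M]

/-- Symplectic forms on manifolds without boundary: smooth, closed, nondegenerate `2`-forms. -/
structure IsSymplectic (σ : TwoForm 𝓘(ℝ, F) M) : Prop where
  smooth : ∀ m₀, ContDiffOn ℝ ∞ (σ.inChart 𝓘(ℝ, F) m₀) (extChartAt 𝓘(ℝ, F) m₀).target
  closed : ∀ m₀, ∀ y ∈ (extChartAt 𝓘(ℝ, F) m₀).target, extDeriv (σ.inChart 𝓘(ℝ, F) m₀) y = 0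
  nondegenerate : ∀ m v, (∀ w, σ m ![v, w] = 0) → v = 0

variable (F M) in
/-- Fields of tangent subspaces. -/
abbrev Distribution := ∀ m : M, Submodule ℝ (TangentSpace 𝓘(ℝ, F) m)

/-- `D` is (the tangent distribution of) a smooth foliation with `k`-dimensional leaves: around
each point there is a smooth chart of `M` that takes `D` to the parallel copies of a fixed
`k`-dimensional subspace. -/
def IsFoliation (k : ℕ) (D : Distribution F M) : Prop :=
  ∀ m₀ : M, ∃ φ ∈ IsManifold.maximalAtlas 𝓘(ℝ, F) ∞ M, m₀ ∈ φ.source ∧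
    ∃ K : Submodule ℝ F, Module.finrank ℝ K = k ∧
      ∀ m ∈ φ.source, ∀ v, v ∈ D m ↔ mvfderiv 𝓘(ℝ, F) φ m v ∈ K

/-- The subspaces of `D` are lagrangian: each is its own symplectic orthogonal. -/
def IsLagrangian (σ : TwoForm 𝓘(ℝ, F) M) (D : Distribution F M) : Prop :=
  ∀ m v, v ∈ D m ↔ ∀ w ∈ D m, σ m ![v, w] = 0

/-- Two points are the end points of a smooth curve tangent to `D`. -/
def TangentJoined (D : Distribution F M) (a c : M) : Prop :=
  ∃ γ : ℝ → M, ContMDiff 𝓘(ℝ, ℝ) 𝓘(ℝ, F) ∞ γ ∧ γ 0 = a ∧ γ 1 = c ∧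
    ∀ t, mfderiv 𝓘(ℝ, ℝ) 𝓘(ℝ, F) γ t (1 : ℝ) ∈ D (γ t)

/-- The leaf through `m`: all points that can be reached from `m` along piecewise smooth curves
tangent to `D`. -/
def leafThrough (D : Distribution F M) (m : M) : Set M :=
  {m' | Relation.ReflTransGen (TangentJoined D) m m'}

variable {E : Type*} [NormedAddCommGroup E] [NormedSpace ℝ E]
  {L : Type*} [TopologicalSpace L] [ChartedSpace E L]

/-- `ι : L → M` identifies the manifold `L` with a leaf of the foliation `D`. -/
structure IsLeaf (D : Distribution F M) (ι : L → M) : Prop where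
  smooth : ContMDiff 𝓘(ℝ, E) 𝓘(ℝ, F) ∞ ι
  injective : Function.Injective ι
  immersion : ∀ x, Function.Injective (mfderiv 𝓘(ℝ, E) 𝓘(ℝ, F) ι x)
  tangent : ∀ x v, v ∈ D (ι x) ↔ ∃ ξ, mfderiv 𝓘(ℝ, E) 𝓘(ℝ, F) ι x ξ = v
  range_eq : ∀ x, range ι = leafThrough D (ι x)

/-- Smooth vector fields on `M`. -/
def IsSmoothField [IsManifold 𝓘(ℝ, F) ∞ M] (X : ∀ m : M, TangentSpace 𝓘(ℝ, F) m) : Prop :=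
  ContMDiff 𝓘(ℝ, F) 𝓘(ℝ, F).tangent ∞ (fun m => (⟨m, X m⟩ : TangentBundle 𝓘(ℝ, F) M))

/-- The flat connection of the affine manifold `L` is the Weinstein connection of the leaf
`ι : L → M` of the lagrangian foliation `D`.  The Weinstein connection is the one that corresponds
by symplectic duality to the dual of the Bott connection `(X, Z) ↦ [X, Z]` on the normal bundle:
`σ(∇_X Y, Z) = X (σ(Y, Z)) - σ(Y, [X, Z])` for `X`, `Y` tangent to `D` and any `Z`. -/
def IsWeinsteinConnection [IsManifold 𝓘(ℝ, F) ∞ M] (σ : TwoForm 𝓘(ℝ, F) M)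
    (D : Distribution F M) (ι : L → M) : Prop :=
  ∀ X Y Z : ∀ m : M, TangentSpace 𝓘(ℝ, F) m,
    IsSmoothField X → IsSmoothField Y → IsSmoothField Z →
    (∀ m, X m ∈ D m) → (∀ m, Y m ∈ D m) →
    ∀ ξ η : ∀ x : L, TangentSpace 𝓘(ℝ, E) x,
      (∀ x, mfderiv 𝓘(ℝ, E) 𝓘(ℝ, F) ι x (ξ x) = X (ι x)) →
      (∀ x, mfderiv 𝓘(ℝ, E) 𝓘(ℝ, F) ι x (η x) = Y (ι x)) →
      ∀ x, σ (ι x) ![mfderiv 𝓘(ℝ, E) 𝓘(ℝ, F) ι x (flatConnection E η x (ξ x)), Z (ι x)] =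
        mvfderiv 𝓘(ℝ, F) (fun m => σ m ![Y m, Z m]) (ι x) (X (ι x)) -
          σ (ι x) ![Y (ι x), VectorField.mlieBracket 𝓘(ℝ, F) X Z (ι x)]

/-- `q : T^*L → M` exhibits `M`, with its `2`-form `σ` and its foliation `D`, as the quotient of
the cotangent bundle of the affine manifold `L`, with the canonical form `∑ dxᵢ ∧ dpᵢ` and the
horizontal foliation `dp₁ = ⋯ = dpₙ = 0`, by fibrewise translations by the lattices `Λ x`; here
`(x, p)` are the natural coordinates that belong to affine charts of `L`. -/
structure IsCotangentQuotient [HasGroupoid L (affineGroupoid E)]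
    (Λ : ∀ x : L, Set (TangentSpace 𝓘(ℝ, E) x →L[ℝ] ℝ))
    (σ : TwoForm 𝓘(ℝ, F) M) (D : Distribution F M) (q : CotangentBundle E L → M) : Prop where
  localDiffeomorph : IsLocalDiffeomorph (𝓘(ℝ, E).prod 𝓘(ℝ, E →L[ℝ] ℝ)) 𝓘(ℝ, F) ∞ q
  surjective : Function.Surjective q
  proj_eq : ∀ z z', q z = q z' → z.proj = z'.proj
  eq_iff : ∀ (x : L) (α β : TangentSpace 𝓘(ℝ, E) x →L[ℝ] ℝ),
    q ⟨x, α⟩ = q ⟨x, β⟩ ↔ α - β ∈ Λ x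
  form : ∀ z, ∀ y ∈ (extChartAt (𝓘(ℝ, E).prod 𝓘(ℝ, E →L[ℝ] ℝ)) z).target,
    ∀ v w : E × (E →L[ℝ] ℝ),
      (σ.pullback 𝓘(ℝ, F) (𝓘(ℝ, E).prod 𝓘(ℝ, E →L[ℝ] ℝ)) q).inChart
        (𝓘(ℝ, E).prod 𝓘(ℝ, E →L[ℝ] ℝ)) z y ![v, w] = w.2 v.1 - v.2 w.1
  horizontal : ∀ z, ∀ z' ∈ (extChartAt (𝓘(ℝ, E).prod 𝓘(ℝ, E →L[ℝ] ℝ)) z).source,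
    ∀ v, mfderiv (𝓘(ℝ, E).prod 𝓘(ℝ, E →L[ℝ] ℝ)) 𝓘(ℝ, F) q z' v ∈ D (q z') ↔
      (mvfderiv (𝓘(ℝ, E).prod 𝓘(ℝ, E →L[ℝ] ℝ))
        (extChartAt (𝓘(ℝ, E).prod 𝓘(ℝ, E →L[ℝ] ℝ)) z) z' v).2 = 0

end Foliations

end LagrangianLeaf

end

open LagrangianLeaf

/-!
In affine charts the parallel transports of an affine manifold `L` are locally constant: with the
discrete topology on `E`, the tangent bundle is a covering space of `L`, and parallel transport is
path lifting in it. If the holonomy is integral in the basis `b`, the covectors that are integral on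
the transports of `b` do not depend on the transporting path. They form a locally constant field of
lattices `Λ ⊂ T*L`.

A coordinate change of `T*L ⧸ Λ` is locally the cotangent lift of an affine map followed by a
constant translation of the momenta, so it preserves both `∑ dxᵢ ∧ dpᵢ` and the distribution
`dp = 0`, and these descend from `T*L`. The zero section is a whole leaf: along a curve tangent to
the distribution the momentum in affine charts is locally constant, and membership in the parallel
field `Λ` is locally constant with it. In such canonical coordinates the defining formula of the
Weinstein connection differentiates the coordinates of `Y` along `X`, as `∇` does.
-/

noncomputable section

namespace LagrangianLeaf

local notation "𝓘Cot(" E ")" => ModelWithCorners.prod 𝓘(ℝ, E) 𝓘(ℝ, E →L[ℝ] ℝ)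

section LocallyConstant

theorem iff_of_forall_eventually_iff {X : Type*} [TopologicalSpace X] [PreconnectedSpace X]
    {P : X → Prop} (hP : ∀ x, ∀ᶠ y in 𝓝 x, (P y ↔ P x)) (x y : X) : P x ↔ P y :=
  iff_of_eq (((IsLocallyConstant.iff_eventually_eq P).2
    fun x => (hP x).mono fun _ => propext).apply_eq_of_preconnectedSpace x y)

theorem continuousAt_iff_eventually_eq {X Y : Type*} [TopologicalSpace X] [TopologicalSpace Y]
    [DiscreteTopology Y] {f : X → Y} {x : X} : ContinuousAt f x ↔ ∀ᶠ y in 𝓝 x, f y = f x := by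
  rw [ContinuousAt, nhds_discrete Y, tendsto_pure]

end LocallyConstant

section ChartDerivatives

variable {E : Type v} [NormedAddCommGroup E] [NormedSpace ℝ E]
  {L : Type u} [TopologicalSpace L] [ChartedSpace E L]

section Smooth

variable [IsManifold 𝓘(ℝ, E) 1 L]

/-- The derivative at `y` of the preferred chart at `x`, where the tangent space at `y` is
identified with `E` by the preferred chart at `y`. -/
def chartDeriv (x y : L) : E →L[ℝ] E := tangentCoordChange 𝓘(ℝ, E) y x y

/-- The inverse of `chartDeriv x y`, for `y` in the source of the chart at `x`. -/
def chartDerivSymm (x y : L) : E →L[ℝ] E := tangentCoordChange 𝓘(ℝ, E) x y y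

theorem chartDeriv_self_apply (x : L) (v : E) : chartDeriv x x v = v :=
  tangentCoordChange_self (mem_extChartAt_source x)

theorem chartDeriv_self (x : L) : chartDeriv (E := E) x x = .id ℝ E :=
  ContinuousLinearMap.ext (chartDeriv_self_apply x)

theorem chartDerivSymm_self (x : L) : chartDerivSymm (E := E) x x = .id ℝ E :=
  chartDeriv_self x

theorem tangentCoordChange_comp_eq {x₁ x₂ x₃ y : L} (h₁ : y ∈ (chartAt E x₁).source)
    (h₂ : y ∈ (chartAt E x₂).source) (h₃ : y ∈ (chartAt E x₃).source) :
    (tangentCoordChange 𝓘(ℝ, E) x₂ x₃ y).comp (tangentCoordChange 𝓘(ℝ, E) x₁ x₂ y) =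
      tangentCoordChange 𝓘(ℝ, E) x₁ x₃ y := by
  rw [← extChartAt_source 𝓘(ℝ, E)] at h₁ h₂ h₃
  exact ContinuousLinearMap.ext fun _ => tangentCoordChange_comp ⟨⟨h₁, h₂⟩, h₃⟩

theorem chartDeriv_comp_symm {x y : L} (hy : y ∈ (chartAt E x).source) :
    (chartDeriv (E := E) x y).comp (chartDerivSymm x y) = .id ℝ E :=
  (tangentCoordChange_comp_eq hy (mem_chart_source E y) hy).trans <|
    ContinuousLinearMap.ext fun _ => tangentCoordChange_self (by rwa [extChartAt_source])

theorem chartDerivSymm_comp {x y : L} (hy : y ∈ (chartAt E x).source) :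
    (chartDerivSymm (E := E) x y).comp (chartDeriv x y) = .id ℝ E :=
  (tangentCoordChange_comp_eq (mem_chart_source E y) hy (mem_chart_source E y)).trans <|
    chartDeriv_self y

/-- The derivative of a chart, as a linear equivalence. -/
def chartDerivEquiv {x y : L} (hy : y ∈ (chartAt E x).source) : E ≃L[ℝ] E :=
  .equivOfInverse (chartDeriv x y) (chartDerivSymm x y)
    (DFunLike.congr_fun (chartDerivSymm_comp hy)) (DFunLike.congr_fun (chartDeriv_comp_symm hy))

theorem mfderiv_extChartAt_eq_chartDeriv {x y : L} (hy : y ∈ (chartAt E x).source) :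
    mfderiv 𝓘(ℝ, E) 𝓘(ℝ, E) (extChartAt 𝓘(ℝ, E) x) y = chartDeriv (E := E) x y := by
  rw [← TangentBundle.continuousLinearMapAt_trivializationAt hy,
    TangentBundle.continuousLinearMapAt_trivializationAt_eq_core hy]
  rfl

theorem mvfderiv_extChartAt_eq_chartDeriv {x y : L} (hy : y ∈ (chartAt E x).source) (v : E) :
    mvfderiv 𝓘(ℝ, E) (extChartAt 𝓘(ℝ, E) x) y v = chartDeriv (E := E) x y v :=
  DFunLike.congr_fun (mfderiv_extChartAt_eq_chartDeriv hy) v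

end Smooth

variable [HasGroupoid L (affineGroupoid E)]

theorem exists_affineMap_eventually_chartAt_eq {x x' y₀ : L} (hx : y₀ ∈ (chartAt E x).source)
    (hx' : y₀ ∈ (chartAt E x').source) :
    ∃ A : E →ᴬ[ℝ] E, ∀ᶠ y in 𝓝 y₀, chartAt E x' y = A (chartAt E x y) ∧
      tangentCoordChange 𝓘(ℝ, E) x x' y = A.contLinear := by
  have hP := (mem_groupoid_of_pregroupoid.1 <| HasGroupoid.compatible (G := affineGroupoid E)
    (chart_mem_atlas E x) (chart_mem_atlas E x')).1
  have hs : chartAt E x y₀ ∈ ((chartAt E x).symm ≫ₕ chartAt E x').source := by simp [hx, hx']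
  obtain ⟨A, hA⟩ := hP _ hs
  rw [((chartAt E x).symm ≫ₕ chartAt E x').open_source.nhdsWithin_eq hs] at hA
  refine ⟨A, ?_⟩
  have hcont : Tendsto (chartAt E x) (𝓝 y₀) (𝓝 (chartAt E x y₀)) :=
    (chartAt E x).continuousAt hx
  filter_upwards [hcont.eventually hA.eventually_nhds,
    (chartAt E x).open_source.mem_nhds hx] with y hy hyx
  constructor
  · simpa [hyx] using hy.self_of_nhds
  · have hyA : extChartAt 𝓘(ℝ, E) x' ∘ (extChartAt 𝓘(ℝ, E) x).symm
        =ᶠ[𝓝 (extChartAt 𝓘(ℝ, E) x y)] A := hy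
    rw [tangentCoordChange_def, modelWithCornersSelf_coe, range_id, fderivWithin_univ,
      hyA.fderiv_eq]
    exact A.hasFDerivAt.fderiv

theorem eventually_tangentCoordChange_eq {x x' y₀ : L} (hx : y₀ ∈ (chartAt E x).source)
    (hx' : y₀ ∈ (chartAt E x').source) :
    ∀ᶠ y in 𝓝 y₀, tangentCoordChange 𝓘(ℝ, E) x x' y = tangentCoordChange 𝓘(ℝ, E) x x' y₀ := by
  obtain ⟨A, hA⟩ := exists_affineMap_eventually_chartAt_eq hx hx'
  exact hA.mono fun y hy => hy.2.trans hA.self_of_nhds.2.symm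

theorem eventually_chartDerivSymm_eq_comp {x y₀ : L} (hy₀ : y₀ ∈ (chartAt E x).source) :
    ∀ᶠ y in 𝓝 y₀, chartDerivSymm (E := E) x y =
      (chartDerivSymm y₀ y).comp (chartDerivSymm x y₀) := by
  filter_upwards [eventually_tangentCoordChange_eq hy₀ (mem_chart_source E y₀),
    (chartAt E x).open_source.mem_nhds hy₀, chart_source_mem_nhds E y₀] with y hy hyx hyy₀
  rw [chartDerivSymm, chartDerivSymm, chartDerivSymm, ← hy]
  exact (tangentCoordChange_comp_eq hyx hyy₀ (mem_chart_source E y)).symm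

theorem exists_eventually_chartAt_eq_chartDeriv_add {x y₀ : L}
    (hy₀ : y₀ ∈ (chartAt E x).source) :
    ∃ c : E, ∀ᶠ y in 𝓝 y₀, chartAt E x y = chartDeriv x y₀ (chartAt E y₀ y) + c := by
  obtain ⟨A, hA⟩ := exists_affineMap_eventually_chartAt_eq (mem_chart_source E y₀) hy₀
  refine ⟨A 0, hA.mono fun y hy => ?_⟩
  rw [hy.1, chartDeriv, hA.self_of_nhds.2]
  exact congr_fun A.decomp _

end ChartDerivatives

section PhaseSpace

variable (E : Type v) [NormedAddCommGroup E] [NormedSpace ℝ E]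

/-- The phase space of `E`, on which cotangent bundles of manifolds modelled on `E` are modelled:
pairs of a position and a momentum. -/
abbrev PhaseSpace : Type v := E × (E →L[ℝ] ℝ)

variable {E}

/-- The action of a linear change of coordinates on positions and momenta. -/
def cotangentLift (a : E ≃L[ℝ] E) : PhaseSpace E ≃L[ℝ] PhaseSpace E :=
  a.prodCongr (a.arrowCongr (.refl ℝ ℝ))

theorem cotangentLift_apply (a : E ≃L[ℝ] E) (y : PhaseSpace E) :
    cotangentLift a y = (a y.1, y.2.comp (a.symm : E →L[ℝ] E)) := rfl

end PhaseSpace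

section CotangentCoordinates

variable {E : Type v} [NormedAddCommGroup E] [NormedSpace ℝ E]
  {L : Type u} [TopologicalSpace L] [ChartedSpace E L]

section Smooth

variable [IsManifold 𝓘(ℝ, E) 1 L]

/-- The covector at a point of the cotangent bundle, in the preferred chart at its base point. -/
def covector (z : CotangentBundle E L) : E →L[ℝ] ℝ := z.snd

/-- The point of the cotangent bundle over `x` that has the momentum `p` in the preferred chart
at `x`. -/
def ofCovector (x : L) (p : E →L[ℝ] ℝ) : CotangentBundle E L := ⟨x, p⟩

theorem continuous_cotangent_proj :
    Continuous (TotalSpace.proj : CotangentBundle E L → L) :=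
  FiberBundle.continuous_proj (E →L[ℝ] ℝ) (fun x : L => TangentSpace 𝓘(ℝ, E) x →L[ℝ] ℝ)

theorem cotangent_extChartAt_source (z : CotangentBundle E L) :
    (extChartAt 𝓘Cot(E) z).source = TotalSpace.proj ⁻¹' (chartAt E z.proj).source := by
  rw [FiberBundle.extChartAt]
  ext w
  simp only [mfld_simps, hom_trivializationAt_source]
  exact ⟨fun h => h.1.1, fun h => ⟨⟨h, trivial⟩, h⟩⟩

theorem cotangent_extChartAt_target (z : CotangentBundle E L) :
    (extChartAt 𝓘Cot(E) z).target = (chartAt E z.proj).target ×ˢ univ := by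
  rw [FiberBundle.extChartAt_target]
  ext w
  simp only [mfld_simps, hom_trivializationAt_baseSet]
  exact ⟨fun h => h.1, fun h => ⟨h, (chartAt E z.proj).map_target h, trivial⟩⟩

theorem cotangent_extChartAt_apply (z w : CotangentBundle E L)
    (hw : w.proj ∈ (chartAt E z.proj).source) :
    extChartAt 𝓘Cot(E) z w =
      (chartAt E z.proj w.proj, (covector w).comp (chartDerivSymm z.proj w.proj)) := by
  rw [extChartAt_coe]
  simp only [Function.comp, hom_chart]
  refine Prod.ext rfl (ContinuousLinearMap.ext fun v => ?_)
  change (ContinuousLinearMap.inCoordinates E (TangentSpace 𝓘(ℝ, E)) ℝ (Bundle.Trivial L ℝ)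
    z.proj w.proj z.proj w.proj w.snd) v = _
  rw [ContinuousLinearMap.inCoordinates,
    TangentBundle.symmL_trivializationAt_eq_core (I := 𝓘(ℝ, E)) hw]
  change ((Bundle.Trivial.trivialization L ℝ).continuousLinearMapAt ℝ w.proj) _ = _
  rw [Bundle.Trivial.continuousLinearMapAt_trivialization]
  rfl

theorem cotangent_extChartAt_self (z : CotangentBundle E L) :
    extChartAt 𝓘Cot(E) z z = (chartAt E z.proj z.proj, covector z) := by
  rw [cotangent_extChartAt_apply z z (mem_chart_source E _), chartDerivSymm_self,
    ContinuousLinearMap.comp_id]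

theorem cotangent_extChartAt_symm_apply (z : CotangentBundle E L) {u : E} {p : E →L[ℝ] ℝ}
    (hu : u ∈ (chartAt E z.proj).target) :
    (extChartAt 𝓘Cot(E) z).symm (u, p) = ofCovector ((chartAt E z.proj).symm u)
      (p.comp (chartDeriv z.proj ((chartAt E z.proj).symm u))) := by
  set y := (chartAt E z.proj).symm u
  have hy : y ∈ (chartAt E z.proj).source := (chartAt E z.proj).map_target hu
  have hw : extChartAt 𝓘Cot(E) z (ofCovector y (p.comp (chartDeriv z.proj y))) = (u, p) := by
    rw [cotangent_extChartAt_apply z _ hy]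
    refine Prod.ext ((chartAt E z.proj).right_inv hu) ?_
    change (p.comp (chartDeriv z.proj y)).comp (chartDerivSymm z.proj y) = p
    rw [ContinuousLinearMap.comp_assoc, chartDeriv_comp_symm hy, ContinuousLinearMap.comp_id]
  rw [← hw]
  exact (extChartAt 𝓘Cot(E) z).left_inv (by rwa [cotangent_extChartAt_source])

end Smooth

variable [HasGroupoid L (affineGroupoid E)]

theorem eventually_cotangent_extChartAt_eq {z z₀ : CotangentBundle E L}
    (h : z₀.proj ∈ (chartAt E z.proj).source) :
    ∃ (a : E ≃L[ℝ] E) (c : PhaseSpace E), ∀ᶠ w in 𝓝 z₀,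
      extChartAt 𝓘Cot(E) z w = cotangentLift a (extChartAt 𝓘Cot(E) z₀ w) + c := by
  obtain ⟨c, hc⟩ := exists_eventually_chartAt_eq_chartDeriv_add h
  refine ⟨chartDerivEquiv h, (c, 0), ?_⟩
  have hproj : Tendsto TotalSpace.proj (𝓝 z₀) (𝓝 z₀.proj) :=
    continuous_cotangent_proj.continuousAt
  filter_upwards [hproj.eventually hc, hproj.eventually (eventually_chartDerivSymm_eq_comp h),
    hproj.eventually ((chartAt E z.proj).open_source.mem_nhds h),
    hproj.eventually (chart_source_mem_nhds E z₀.proj)] with w hw hsymm hwz hwz₀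
  rw [cotangent_extChartAt_apply z w hwz, cotangent_extChartAt_apply z₀ w hwz₀,
    cotangentLift_apply]
  refine Prod.ext hw ?_
  change _ = ((covector w).comp (chartDerivSymm z₀.proj w.proj)).comp
    (chartDerivSymm z.proj z₀.proj) + 0
  rw [add_zero, ContinuousLinearMap.comp_assoc, hsymm]

end CotangentCoordinates

section ParallelTransport

variable {E : Type v} [NormedAddCommGroup E] [NormedSpace ℝ E]
  {L : Type u} [TopologicalSpace L] [ChartedSpace E L] [HasGroupoid L (affineGroupoid E)]

/-- A copy of `E` with the discrete topology, the fibre of the flat tangent bundle. -/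
def DiscreteFiber (E : Type v) : Type v := E

instance : TopologicalSpace (DiscreteFiber E) := ⊥

instance : DiscreteTopology (DiscreteFiber E) := ⟨rfl⟩

variable (E L) in
/-- The tangent bundle of an affine manifold with the topology in which its fibres are discrete.
Its continuous sections are the parallel vector fields, so that parallel transport is the lifting
of paths to this covering of `L`. -/
def flatBundleCore : FiberBundleCore L L (DiscreteFiber E) where
  baseSet x := (chartAt E x).source
  isOpen_baseSet x := (chartAt E x).open_source
  indexAt x := x
  mem_baseSet_at := mem_chart_source E
  coordChange x x' y := fun v : E => tangentCoordChange 𝓘(ℝ, E) x x' y v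
  coordChange_self _ _ hy (v : E) :=
    tangentCoordChange_self (v := v) (by rwa [extChartAt_source])
  continuousOn_coordChange x x' := by
    rintro ⟨y₀, v₀⟩ ⟨⟨hx, hx'⟩, -⟩
    refine (continuousAt_iff_eventually_eq.2 ?_).continuousWithinAt
    filter_upwards [continuousAt_fst.eventually (eventually_tangentCoordChange_eq hx hx'),
      continuousAt_iff_eventually_eq.1 continuousAt_snd] with z hz hz'
    exact congr_arg₂ (fun (T : E →L[ℝ] E) (v : E) => T v) hz hz'
  coordChange_comp x₁ x₂ x₃ y hy :=
    DFunLike.congr_fun (tangentCoordChange_comp_eq hy.1.1 hy.1.2 hy.2)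

variable (E L) in
/-- The total space of `flatBundleCore`. -/
abbrev FlatBundle : Type (max u v) := (flatBundleCore E L).TotalSpace

theorem isCoveringMap_flatBundle_proj : IsCoveringMap (TotalSpace.proj : FlatBundle E L → L) :=
  FiberBundle.isCoveringMap

variable {X : Type*} [TopologicalSpace X]

/-- `W` is a parallel vector field along `γ`; its value at `t` is given in the preferred chart
at `γ t`. -/
def IsParallelField (γ : X → L) (W : X → E) : Prop :=
  ∀ t₀, ∀ᶠ t in 𝓝 t₀, chartDeriv (γ t₀) (γ t) (W t) = W t₀

theorem isParallelField_iff_continuous {γ : X → L} (hγ : Continuous γ) {W : X → E} :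
    IsParallelField γ W ↔ Continuous fun t => (⟨γ t, W t⟩ : FlatBundle E L) := by
  refine (forall_congr' fun t₀ => ?_).trans continuous_iff_continuousAt.symm
  rw [FiberBundle.continuousAt_totalSpace (DiscreteFiber E), and_iff_right hγ.continuousAt]
  refine Iff.trans (eventually_congr <| .of_forall fun t => ?_) continuousAt_iff_eventually_eq.symm
  exact Eq.congr_right (chartDeriv_self_apply (γ t₀) (W t₀)).symm

theorem isParallelTransport_iff {x y : L} (γ : Path x y) (v w : E) :
    IsParallelTransport (E := E) γ v w ↔
      ∃ W : unitInterval → E, IsParallelField γ W ∧ W 0 = v ∧ W 1 = w := by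
  have hnear t₀ : ∀ᶠ t in 𝓝 t₀, γ t ∈ (chartAt E (γ t₀)).source :=
    γ.continuous.continuousAt.eventually (chart_source_mem_nhds E (γ t₀))
  have hcoord {t₀ t : unitInterval} (ht : γ t ∈ (chartAt E (γ t₀)).source) (v v₀ : E) :
      mvfderiv 𝓘(ℝ, E) (extChartAt 𝓘(ℝ, E) (γ t₀)) (γ t) v =
        mvfderiv 𝓘(ℝ, E) (extChartAt 𝓘(ℝ, E) (γ t₀)) (γ t₀) v₀ ↔
      chartDeriv (γ t₀) (γ t) v = v₀ := by
    rw [mvfderiv_extChartAt_eq_chartDeriv ht,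
      mvfderiv_extChartAt_eq_chartDeriv (mem_chart_source E _), chartDeriv_self_apply]
  constructor
  · rintro ⟨V, hV, hpar, h0, h1⟩
    refine ⟨fun t => (V t).snd, fun t₀ => ?_, congrArg (fun p => (p.snd : E)) h0,
      congrArg (fun p => (p.snd : E)) h1⟩
    filter_upwards [hpar t₀, hnear t₀] with t ht hγt
    refine (hcoord hγt _ _).1 ?_
    rw [← hV t, ← hV t₀]
    exact ht
  · rintro ⟨W, hW, h0, h1⟩
    refine ⟨fun t => ⟨γ t, W t⟩, fun _ => rfl, fun t₀ => ?_,
      TotalSpace.ext γ.source (heq_of_eq h0), TotalSpace.ext γ.target (heq_of_eq h1)⟩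
    filter_upwards [hW t₀, hnear t₀] with t ht hγt
    exact (hcoord hγt _ _).2 ht

theorem isParallelTransport_iff_exists_lift {x y : L} (γ : Path x y) (v w : E) :
    IsParallelTransport (E := E) γ v w ↔
      ∃ Γ : Path (⟨x, v⟩ : FlatBundle E L) ⟨y, w⟩,
        Γ.map isCoveringMap_flatBundle_proj.continuous = γ := by
  rw [isParallelTransport_iff]
  constructor
  · rintro ⟨W, hW, rfl, rfl⟩
    exact ⟨⟨⟨fun t => ⟨γ t, W t⟩, (isParallelField_iff_continuous γ.continuous).1 hW⟩,
      TotalSpace.ext γ.source HEq.rfl, TotalSpace.ext γ.target HEq.rfl⟩, rfl⟩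
  · rintro ⟨Γ, rfl⟩
    refine ⟨fun t => (Γ t).snd, ?_, ?_, ?_⟩
    · exact (isParallelField_iff_continuous (Path.continuous _)).2 Γ.continuous
    · exact congrArg (fun p : FlatBundle E L => (p.snd : E)) Γ.source
    · exact congrArg (fun p : FlatBundle E L => (p.snd : E)) Γ.target

namespace IsParallelTransport

variable {x y z : L} {γ : Path x y} {v w v' w' : E}

theorem unique (h : IsParallelTransport (E := E) γ v w) (h' : IsParallelTransport (E := E) γ v w') :
    w = w' := by
  obtain ⟨Γ, hΓ⟩ := (isParallelTransport_iff_exists_lift γ v w).1 h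
  obtain ⟨Γ', hΓ'⟩ := (isParallelTransport_iff_exists_lift γ v w').1 h'
  have hcomp : TotalSpace.proj ∘ Γ = TotalSpace.proj ∘ Γ' :=
    congrArg DFunLike.coe (hΓ.trans hΓ'.symm)
  have hend := congrFun (isCoveringMap_flatBundle_proj.eq_of_comp_eq Γ.continuous Γ'.continuous
    hcomp 0 (Γ.source.trans Γ'.source.symm)) 1
  rw [Γ.target, Γ'.target] at hend
  exact congrArg (fun p : FlatBundle E L => (p.snd : E)) hend

theorem symm (h : IsParallelTransport (E := E) γ v w) :
    IsParallelTransport (E := E) γ.symm w v := by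
  obtain ⟨Γ, rfl⟩ := (isParallelTransport_iff_exists_lift γ v w).1 h
  exact (isParallelTransport_iff_exists_lift _ w v).2 ⟨Γ.symm, rfl⟩

theorem trans {δ : Path y z} {u : E} (h : IsParallelTransport (E := E) γ v w)
    (h' : IsParallelTransport (E := E) δ w u) : IsParallelTransport (E := E) (γ.trans δ) v u := by
  obtain ⟨Γ, rfl⟩ := (isParallelTransport_iff_exists_lift γ v w).1 h
  obtain ⟨Δ, rfl⟩ := (isParallelTransport_iff_exists_lift δ w u).1 h'
  exact (isParallelTransport_iff_exists_lift _ v u).2 ⟨Γ.trans Δ, Path.map_trans ..⟩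

theorem add (h : IsParallelTransport (E := E) γ v w) (h' : IsParallelTransport (E := E) γ v' w') :
    IsParallelTransport (E := E) γ (v + v') (w + w') := by
  obtain ⟨W, hW, rfl, rfl⟩ := (isParallelTransport_iff γ v w).1 h
  obtain ⟨W', hW', rfl, rfl⟩ := (isParallelTransport_iff γ v' w').1 h'
  refine (isParallelTransport_iff _ _ _).2 ⟨W + W', fun t₀ => ?_, rfl, rfl⟩
  filter_upwards [hW t₀, hW' t₀] with t ht ht'
  rw [Pi.add_apply, map_add, ht, ht', Pi.add_apply]

theorem smul (c : ℝ) (h : IsParallelTransport (E := E) γ v w) :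
    IsParallelTransport (E := E) γ (c • v) (c • w) := by
  obtain ⟨W, hW, rfl, rfl⟩ := (isParallelTransport_iff γ v w).1 h
  refine (isParallelTransport_iff _ _ _).2 ⟨c • W, fun t₀ => ?_, rfl, rfl⟩
  filter_upwards [hW t₀] with t ht
  rw [Pi.smul_apply, map_smul, ht, Pi.smul_apply]

end IsParallelTransport

theorem isParallelTransport_refl (x : L) (v : E) :
    IsParallelTransport (E := E) (Path.refl x) v v :=
  (isParallelTransport_iff_exists_lift _ v v).2 ⟨.refl _, rfl⟩

theorem exists_isParallelTransport {x y : L} (γ : Path x y) (v : E) :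
    ∃ w : E, IsParallelTransport (E := E) γ v w := by
  let Γ := isCoveringMap_flatBundle_proj.liftPath γ.toContinuousMap
    (⟨x, v⟩ : FlatBundle E L) γ.source
  have hΓ t : (Γ t).proj = γ t :=
    congrFun (isCoveringMap_flatBundle_proj.liftPath_lifts γ.toContinuousMap _ γ.source) t
  have hend : Γ 1 = (⟨y, (Γ 1).snd⟩ : FlatBundle E L) :=
    TotalSpace.ext ((hΓ 1).trans γ.target) HEq.rfl
  exact ⟨(Γ 1).snd, (isParallelTransport_iff_exists_lift γ v _).2
    ⟨⟨Γ, isCoveringMap_flatBundle_proj.liftPath_zero .., hend⟩, Path.ext (funext hΓ)⟩⟩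

theorem exists_linearEquiv_isParallelTransport {x y : L} (γ : Path x y) :
    ∃ A : E ≃ₗ[ℝ] E, ∀ v, IsParallelTransport (E := E) γ v (A v) := by
  choose A hA using exists_isParallelTransport (E := E) γ
  choose B hB using exists_isParallelTransport (E := E) γ.symm
  exact ⟨{
    toFun := A
    invFun := B
    map_add' v w := (hA _).unique ((hA v).add (hA w))
    map_smul' c v := (hA _).unique ((hA v).smul c)
    left_inv v := (hB _).unique (hA v).symm
    right_inv w := (hA _).unique (γ.symm_symm ▸ (hB w).symm) }, hA⟩

theorem isParallelTransport_of_forall_mem_chartAt_source (x : L) {y y' : L} (γ : Path y y')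
    (hγ : ∀ t, γ t ∈ (chartAt E x).source) {w w' : E}
    (h : chartDeriv x y w = chartDeriv x y' w') : IsParallelTransport (E := E) γ w w' := by
  refine (isParallelTransport_iff _ _ _).2
    ⟨fun t => chartDerivSymm x (γ t) (chartDeriv x y w), fun t₀ => ?_, ?_, ?_⟩
  · filter_upwards [
      γ.continuous.continuousAt.eventually (eventually_chartDerivSymm_eq_comp (hγ t₀)),
      γ.continuous.continuousAt.eventually (chart_source_mem_nhds E (γ t₀))] with t ht hγt
    rw [ht]
    exact DFunLike.congr_fun (chartDeriv_comp_symm hγt) _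
  · have hy := hγ 0
    rw [γ.source] at hy
    simp only [γ.source]
    exact DFunLike.congr_fun (chartDerivSymm_comp hy) w
  · have hy' := hγ 1
    rw [γ.target] at hy'
    simp only [γ.target, h]
    exact DFunLike.congr_fun (chartDerivSymm_comp hy') w'

end ParallelTransport

section ZLattice

theorem exists_isCompact_forall_exists_sub_mem {V : Type*} [NormedAddCommGroup V]
    [NormedSpace ℝ V] [FiniteDimensional ℝ V] (Λ : Submodule ℤ V) [DiscreteTopology Λ]
    [IsZLattice ℝ Λ] : ∃ C : Set V, IsCompact C ∧ ∀ p, ∃ c ∈ C, p - c ∈ Λ := by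
  have : ProperSpace V := FiniteDimensional.proper_real V
  let b₀ := Module.Free.chooseBasis ℤ Λ
  let b := b₀.ofZLatticeBasis ℝ Λ
  refine ⟨closure (ZSpan.fundamentalDomain b),
    (ZSpan.fundamentalDomain_isBounded b).isCompact_closure, fun p =>
      ⟨ZSpan.fract b p, subset_closure (ZSpan.fract_mem_fundamentalDomain b p), ?_⟩⟩
  rw [ZSpan.fract_apply, sub_sub_cancel]
  exact (b₀.ofZLatticeBasis_span ℝ Λ).le (ZSpan.floor b p).2

theorem isClosed_of_discreteTopology {V : Type*} [NormedAddCommGroup V] (Λ : Submodule ℤ V)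
    [DiscreteTopology Λ] : IsClosed (Λ : Set V) :=
  AddSubgroup.isClosed_of_discrete (H := Λ.toAddSubgroup)

theorem eventually_mem_imp_eq_zero {V : Type*} [AddCommGroup V] [TopologicalSpace V]
    (Λ : Submodule ℤ V) [DiscreteTopology Λ] : ∀ᶠ p in 𝓝 (0 : V), p ∈ Λ → p = 0 := by
  obtain ⟨U, hU, hUΛ⟩ := isOpen_induced_iff.1 (isOpen_discrete {(0 : Λ)})
  filter_upwards [hU.mem_nhds (hUΛ.ge rfl : (0 : Λ) ∈ Subtype.val ⁻¹' U)] with p hp hpΛ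
  have hzero : (⟨p, hpΛ⟩ : Λ) ∈ ({0} : Set Λ) := hUΛ.le hp
  exact congrArg Subtype.val hzero

end ZLattice

section TorusBundle

variable {E : Type v} [NormedAddCommGroup E] [NormedSpace ℝ E]
  {L : Type u} [TopologicalSpace L] [ChartedSpace E L] [IsManifold 𝓘(ℝ, E) 1 L]

variable (E L) in
/-- A locally constant field of lattices in the cotangent spaces of an affine manifold. The
lattice at `x` is given in the preferred chart at `x`. -/
structure ParallelLattice where
  /-- The lattice at a point. -/
  fiber : L → Submodule ℤ (E →L[ℝ] ℝ)
  [discreteTopology : ∀ x, DiscreteTopology (fiber x)]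
  [isZLattice : ∀ x, IsZLattice ℝ (fiber x)]
  eventually_mem_iff : ∀ x, ∀ᶠ y in 𝓝 x, ∀ p : E →L[ℝ] ℝ,
    p ∈ fiber x ↔ p.comp (chartDeriv x y) ∈ fiber y

attribute [instance] ParallelLattice.discreteTopology ParallelLattice.isZLattice

/-- Points of the cotangent bundle that differ by a covector of the lattice. -/
def ParallelLattice.setoid (Λ : ParallelLattice E L) : Setoid (CotangentBundle E L) where
  r z w := z.proj = w.proj ∧ covector z - covector w ∈ Λ.fiber z.proj
  iseqv :=
    { refl z := ⟨rfl, by rw [sub_self]; exact zero_mem _⟩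
      symm {z w} h := ⟨h.1.symm, h.1 ▸ sub_mem_comm_iff.1 h.2⟩
      trans {z w y} h h' := ⟨h.1.trans h'.1, by
        rw [← sub_add_sub_cancel _ (covector w)]
        exact add_mem h.2 (h.1 ▸ h'.2)⟩ }

/-- The torus bundle obtained from the cotangent bundle by dividing each fibre by its lattice. -/
def TorusBundle (Λ : ParallelLattice E L) : Type (max u v) := Quotient Λ.setoid

variable {Λ : ParallelLattice E L}

instance : TopologicalSpace (TorusBundle Λ) :=
  inferInstanceAs (TopologicalSpace (Quotient Λ.setoid))

variable (Λ) in
/-- The projection of the cotangent bundle to the torus bundle. -/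
def toTorus : CotangentBundle E L → TorusBundle Λ := Quotient.mk Λ.setoid

variable (Λ) in
/-- The projection of the torus bundle to the base. -/
def torusProj : TorusBundle Λ → L :=
  Quotient.lift (s := Λ.setoid) TotalSpace.proj fun _ _ h => h.1

theorem continuous_toTorus : Continuous (toTorus Λ) := continuous_quotient_mk'

theorem toTorus_surjective : Function.Surjective (toTorus Λ) := Quotient.mk_surjective

theorem toTorus_eq_iff {z w : CotangentBundle E L} :
    toTorus Λ z = toTorus Λ w ↔
      z.proj = w.proj ∧ covector z - covector w ∈ Λ.fiber z.proj :=
  Quotient.eq (r := Λ.setoid)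

theorem eventually_toTorus_eq_iff (Λ : ParallelLattice E L) (z : CotangentBundle E L) :
    ∀ᶠ y in 𝓝 z.proj, ∀ w w' : CotangentBundle E L, w.proj = y → w'.proj = y →
      (toTorus Λ w = toTorus Λ w' ↔
        (extChartAt 𝓘Cot(E) z w).2 - (extChartAt 𝓘Cot(E) z w').2 ∈ Λ.fiber z.proj) := by
  filter_upwards [Λ.eventually_mem_iff z.proj, chart_source_mem_nhds E z.proj]
    with y hy hyz w w' hw hw'
  rw [cotangent_extChartAt_apply z w (by rwa [hw]), cotangent_extChartAt_apply z w' (by rwa [hw']),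
    toTorus_eq_iff]
  simp only [hw, hw', true_and]
  rw [hy, ← ContinuousLinearMap.sub_comp, ContinuousLinearMap.comp_assoc,
    chartDerivSymm_comp hyz, ContinuousLinearMap.comp_id]

theorem eventually_toTorus_translate (z : CotangentBundle E L) {l : E →L[ℝ] ℝ}
    (hl : l ∈ Λ.fiber z.proj) :
    ∀ᶠ w in 𝓝 z, extChartAt 𝓘Cot(E) z w + (0, l) ∈ (extChartAt 𝓘Cot(E) z).target ∧
      toTorus Λ ((extChartAt 𝓘Cot(E) z).symm (extChartAt 𝓘Cot(E) z w + (0, l))) =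
        toTorus Λ w := by
  have hproj : Tendsto TotalSpace.proj (𝓝 z) (𝓝 z.proj) := continuous_cotangent_proj.continuousAt
  filter_upwards [hproj.eventually (eventually_toTorus_eq_iff Λ z),
    hproj.eventually (chart_source_mem_nhds E z.proj)] with w hw hwz
  have htarget : extChartAt 𝓘Cot(E) z w + (0, l) ∈ (extChartAt 𝓘Cot(E) z).target := by
    rw [cotangent_extChartAt_target, cotangent_extChartAt_apply z w hwz, Prod.mk_add_mk, add_zero]
    exact ⟨(chartAt E z.proj).map_source hwz, trivial⟩
  refine ⟨htarget, (hw _ w ?_ rfl).2 ?_⟩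
  · rw [cotangent_extChartAt_apply z w hwz, Prod.mk_add_mk, add_zero,
      cotangent_extChartAt_symm_apply z ((chartAt E z.proj).map_source hwz)]
    exact (chartAt E z.proj).left_inv hwz
  · rwa [(extChartAt 𝓘Cot(E) z).right_inv htarget, Prod.snd_add, add_sub_cancel_left]

theorem exists_local_translation {z₀ z₁ : CotangentBundle E L} (h : toTorus Λ z₀ = toTorus Λ z₁) :
    ∃ τ : CotangentBundle E L → CotangentBundle E L, ContinuousAt τ z₀ ∧ τ z₀ = z₁ ∧
      ∃ c : PhaseSpace E, ∀ᶠ w in 𝓝 z₀, toTorus Λ (τ w) = toTorus Λ w ∧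
        extChartAt 𝓘Cot(E) z₁ (τ w) = extChartAt 𝓘Cot(E) z₀ w + c := by
  obtain ⟨hx, hl⟩ := toTorus_eq_iff.1 h.symm
  have hchart : extChartAt 𝓘Cot(E) z₁ = extChartAt 𝓘Cot(E) z₀ := by
    simp only [FiberBundle.extChartAt, hx]
  set e := extChartAt 𝓘Cot(E) z₀
  have hz₁ : e z₀ + (0, covector z₁ - covector z₀) = e z₁ := by
    rw [← hchart, cotangent_extChartAt_self, hchart, cotangent_extChartAt_self, Prod.mk_add_mk,
      add_zero, add_sub_cancel, hx]
  have hz₁e : z₁ ∈ e.source := hchart ▸ mem_extChartAt_source z₁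
  refine ⟨fun w => e.symm (e w + (0, covector z₁ - covector z₀)), ?_, ?_,
    (0, covector z₁ - covector z₀), ?_⟩
  · refine ContinuousAt.comp (g := e.symm) ?_ ((continuousAt_extChartAt z₀).add continuousAt_const)
    rw [hz₁, ← hchart]
    exact continuousAt_extChartAt_symm z₁
  · simp only [hz₁]
    exact e.left_inv hz₁e
  · filter_upwards [eventually_toTorus_translate z₀ (hx ▸ hl)] with w hw
    exact ⟨hw.2, by rw [hchart, e.right_inv hw.1]⟩

theorem isOpenMap_toTorus : IsOpenMap (toTorus Λ) := by
  intro U hU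
  change IsOpen (toTorus Λ ⁻¹' (toTorus Λ '' U))
  refine isOpen_iff_mem_nhds.2 ?_
  rintro z ⟨w, hw, hwz⟩
  obtain ⟨τ, hτ, hτz, c, hc⟩ := exists_local_translation hwz.symm
  filter_upwards [hc, hτ.eventually (hU.mem_nhds (hτz ▸ hw))] with y hy hyU
  exact ⟨τ y, hyU, hy.1⟩

theorem isOpenQuotientMap_toTorus : IsOpenQuotientMap (toTorus Λ) :=
  ⟨toTorus_surjective, continuous_toTorus, isOpenMap_toTorus⟩

theorem continuousAt_momentum_sub {z z' : CotangentBundle E L} (h : z'.proj = z.proj) :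
    ContinuousAt (fun w : CotangentBundle E L × CotangentBundle E L =>
      (extChartAt 𝓘Cot(E) z w.1).2 - (extChartAt 𝓘Cot(E) z w.2).2) (z, z') := by
  have hz' : z' ∈ (extChartAt 𝓘Cot(E) z).source := by
    rw [cotangent_extChartAt_source, mem_preimage, h]
    exact mem_chart_source E z.proj
  have h₁ : ContinuousAt (fun w : CotangentBundle E L × CotangentBundle E L =>
      extChartAt 𝓘Cot(E) z w.1) (z, z') :=
    (continuousAt_extChartAt z).comp_of_eq continuousAt_fst rfl
  have h₂ : ContinuousAt (fun w : CotangentBundle E L × CotangentBundle E L =>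
      extChartAt 𝓘Cot(E) z w.2) (z, z') :=
    (continuousAt_extChartAt' hz').comp_of_eq continuousAt_snd rfl
  exact h₁.snd.sub h₂.snd

instance [T2Space L] : T2Space (TorusBundle Λ) := by
  rw [t2Space_iff_of_isOpenQuotientMap isOpenQuotientMap_toTorus, ← isOpen_compl_iff,
    isOpen_iff_mem_nhds]
  rintro ⟨z, z'⟩ (hne : toTorus Λ z ≠ toTorus Λ z')
  have hfst : Tendsto (fun w : CotangentBundle E L × CotangentBundle E L => w.1.proj)
      (𝓝 (z, z')) (𝓝 z.proj) := (continuous_cotangent_proj.comp continuous_fst).continuousAt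
  have hsnd : Tendsto (fun w : CotangentBundle E L × CotangentBundle E L => w.2.proj)
      (𝓝 (z, z')) (𝓝 z'.proj) := (continuous_cotangent_proj.comp continuous_snd).continuousAt
  by_cases hx : z'.proj = z.proj
  · have hev := eventually_toTorus_eq_iff Λ z
    have hsub := (continuousAt_momentum_sub hx).eventually
      ((isClosed_of_discreteTopology (Λ.fiber z.proj)).isOpen_compl.mem_nhds
        fun h => hne ((hev.self_of_nhds z z' rfl hx).2 h))
    filter_upwards [hsub, hfst.eventually hev] with w hw hiff hww
    exact hw ((hiff w.1 w.2 rfl (toTorus_eq_iff.1 hww).1.symm).1 hww)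
  · filter_upwards [(hfst.prodMk_nhds hsnd).eventually
      (isClosed_diagonal.isOpen_compl.mem_nhds (Ne.symm hx))] with w hw hww
    exact hw (toTorus_eq_iff.1 hww).1

theorem exists_mem_nhds_injOn_toTorus (z : CotangentBundle E L) :
    ∃ U ∈ 𝓝 z, InjOn (toTorus Λ) U := by
  have hzero : ∀ᶠ w : CotangentBundle E L × CotangentBundle E L in 𝓝 (z, z),
      (extChartAt 𝓘Cot(E) z w.1).2 - (extChartAt 𝓘Cot(E) z w.2).2 ∈ Λ.fiber z.proj →
        (extChartAt 𝓘Cot(E) z w.1).2 - (extChartAt 𝓘Cot(E) z w.2).2 = 0 := by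
    have hcont := continuousAt_momentum_sub (rfl : z.proj = z.proj)
    rw [ContinuousAt, sub_self] at hcont
    exact hcont.eventually (eventually_mem_imp_eq_zero (Λ.fiber z.proj))
  rw [nhds_prod_eq] at hzero
  obtain ⟨U, hU, hUU⟩ := eventually_prod_self_iff'.1 hzero
  refine ⟨_, inter_mem hU (inter_mem (extChartAt_source_mem_nhds (I := 𝓘Cot(E)) z)
    (continuous_cotangent_proj.continuousAt.eventually (eventually_toTorus_eq_iff Λ z))), ?_⟩
  rintro w ⟨hwU, hwz, hw⟩ w' ⟨hwU', hwz', -⟩ hww'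
  have hproj := (toTorus_eq_iff.1 hww').1
  have hmomentum := hUU w hwU w' hwU' ((hw w w' rfl hproj.symm).1 hww')
  refine (extChartAt 𝓘Cot(E) z).injOn hwz hwz' (Prod.ext ?_ (sub_eq_zero.1 hmomentum))
  rw [cotangent_extChartAt_source] at hwz hwz'
  rw [cotangent_extChartAt_apply z w hwz, cotangent_extChartAt_apply z w' hwz']
  exact congrArg (chartAt E z.proj) hproj

theorem isLocalHomeomorph_toTorus : IsLocalHomeomorph (toTorus Λ) := by
  refine IsLocalHomeomorph.mk _ fun z => ?_
  obtain ⟨U, hU, hinj⟩ := exists_mem_nhds_injOn_toTorus (Λ := Λ) z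
  have : Nonempty (CotangentBundle E L) := ⟨z⟩
  exact ⟨OpenPartialHomeomorph.ofContinuousOpen
    ((hinj.mono interior_subset).toPartialEquiv (toTorus Λ) (interior U))
    continuous_toTorus.continuousOn isOpenMap_toTorus isOpen_interior,
    mem_interior_iff_mem_nhds.2 hU, fun _ _ => rfl⟩

variable [FiniteDimensional ℝ E]

variable (Λ) in
theorem exists_mem_nhds_preimage_torusProj_subset (x : L) :
    ∃ K ∈ 𝓝 x, ∃ S : Set (TorusBundle Λ), IsCompact S ∧ torusProj Λ ⁻¹' K ⊆ S := by
  have : LocallyCompactSpace L := ChartedSpace.locallyCompactSpace E L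
  let z : CotangentBundle E L := ofCovector x 0
  obtain ⟨C, hC, hCΛ⟩ := exists_isCompact_forall_exists_sub_mem (Λ.fiber x)
  obtain ⟨K, hKx, hKU, hK⟩ := local_compact_nhds (inter_mem (eventually_toTorus_eq_iff Λ z)
    (chart_source_mem_nhds E x))
  have htarget : (chartAt E x '' K) ×ˢ C ⊆ (extChartAt 𝓘Cot(E) z).target := by
    rw [cotangent_extChartAt_target]
    rintro ⟨u, p⟩ ⟨⟨y, hy, rfl⟩, -⟩
    exact ⟨(chartAt E x).map_source (hKU hy).2, trivial⟩
  refine ⟨K, hKx, toTorus Λ '' ((extChartAt 𝓘Cot(E) z).symm '' ((chartAt E x '' K) ×ˢ C)), ?_, ?_⟩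
  · have hKchart := hK.image_of_continuousOn
      ((chartAt E x).continuousOn.mono fun y hy => (hKU hy).2)
    exact ((hKchart.prod hC).image_of_continuousOn
      ((continuousOn_extChartAt_symm z).mono htarget)).image continuous_toTorus
  · intro m hm
    obtain ⟨w, rfl⟩ := toTorus_surjective m
    replace hm : w.proj ∈ K := hm
    have hwx : w.proj ∈ (chartAt E x).source := (hKU hm).2
    obtain ⟨c, hc, hcΛ⟩ := hCΛ (extChartAt 𝓘Cot(E) z w).2
    have hwc : (chartAt E x w.proj, c) ∈ (chartAt E x '' K) ×ˢ C := ⟨mem_image_of_mem _ hm, hc⟩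
    refine ⟨_, mem_image_of_mem _ hwc, (((hKU hm).1 w _ rfl ?_).2 ?_).symm⟩
    · rw [cotangent_extChartAt_symm_apply z ((chartAt E x).map_source hwx)]
      exact (chartAt E x).left_inv hwx
    · rwa [(extChartAt 𝓘Cot(E) z).right_inv (htarget hwc)]

instance [CompactSpace L] : CompactSpace (TorusBundle Λ) := by
  choose K hK S hS hKS using exists_mem_nhds_preimage_torusProj_subset Λ
  obtain ⟨t, ht⟩ := CompactSpace.elim_nhds_subcover K hK
  have huniv : ⋃ x ∈ t, S x = univ := eq_univ_of_forall fun m => by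
    obtain ⟨x, hx, hm⟩ := mem_iUnion₂.1 (ht.ge (mem_univ (torusProj Λ m)))
    exact mem_iUnion₂.2 ⟨x, hx, hKS x hm⟩
  exact ⟨huniv ▸ t.isCompact_biUnion fun x _ => hS x⟩

end TorusBundle

section HolonomyLattice

variable {E : Type v} [NormedAddCommGroup E] [NormedSpace ℝ E]

/-- The dual basis of `B`, in the topological dual of the finite-dimensional space `E`. -/
def continuousDualBasis {n : ℕ} (B : Module.Basis (Fin n) ℝ E) :
    Module.Basis (Fin n) ℝ (E →L[ℝ] ℝ) :=
  have := B.finiteDimensional_of_finite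
  B.dualBasis.map LinearMap.toContinuousLinearMap

theorem mem_span_int_continuousDualBasis_iff {n : ℕ} (B : Module.Basis (Fin n) ℝ E)
    (p : E →L[ℝ] ℝ) :
    p ∈ Submodule.span ℤ (range (continuousDualBasis B)) ↔ ∀ i, ∃ k : ℤ, p (B i) = k := by
  rw [Module.Basis.mem_span_iff_repr_mem]
  refine forall_congr' fun i => exists_congr fun k => ?_
  have hrepr : (continuousDualBasis B).repr p i = p (B i) := B.dualBasis_repr (p : E →ₗ[ℝ] ℝ) i
  rw [hrepr, eq_comm, algebraMap_int_eq, Int.coe_castRingHom]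

variable {L : Type u} [TopologicalSpace L] [ChartedSpace E L] {n : ℕ} {x₀ : L}
  {b : Module.Basis (Fin n) ℝ (TangentSpace 𝓘(ℝ, E) x₀)}

variable (b) in
/-- The lattice `cotangentLattice b x`, as a group of covectors in the preferred chart at `x`. -/
def holonomyLattice (x : L) : Submodule ℤ (E →L[ℝ] ℝ) :=
  AddSubgroup.toIntSubmodule
    { carrier := cotangentLattice b x
      zero_mem' _ _ _ _ := ⟨0, Int.cast_zero.symm⟩
      add_mem' hp hp' γ i w hw := by
        obtain ⟨k, hk⟩ := hp γ i w hw
        obtain ⟨k', hk'⟩ := hp' γ i w hw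
        exact ⟨k + k', (congrArg₂ (· + ·) hk hk').trans (Int.cast_add k k').symm⟩
      neg_mem' hp γ i w hw := by
        obtain ⟨k, hk⟩ := hp γ i w hw
        exact ⟨-k, (congrArg Neg.neg hk).trans (Int.cast_neg k).symm⟩ }

variable [HasGroupoid L (affineGroupoid E)]

theorem mem_holonomyLattice_iff_of_isParallelTransport {x y : L} (γ : Path x y)
    {p p' : E →L[ℝ] ℝ} (h : ∀ v w : E, IsParallelTransport (E := E) γ v w → p v = p' w) :
    p ∈ holonomyLattice b x ↔ p' ∈ holonomyLattice b y := by
  constructor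
  · intro hp δ i (w : E) hw
    obtain ⟨v, hv⟩ := exists_isParallelTransport γ.symm w
    obtain ⟨k, hk⟩ := hp (δ.trans γ.symm) i v (hw.trans hv)
    exact ⟨k, (h v w (γ.symm_symm ▸ hv.symm)).symm.trans hk⟩
  · intro hp δ i (v : E) hv
    obtain ⟨w, hw⟩ := exists_isParallelTransport γ v
    obtain ⟨k, hk⟩ := hp (δ.trans γ) i w (hv.trans hw)
    exact ⟨k, (h v w hw).trans hk⟩

theorem eventually_mem_holonomyLattice_iff
    (b : Module.Basis (Fin n) ℝ (TangentSpace 𝓘(ℝ, E) x₀)) (x : L) :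
    ∀ᶠ y in 𝓝 x, ∀ p : E →L[ℝ] ℝ,
      p ∈ holonomyLattice b x ↔ p.comp (chartDeriv x y) ∈ holonomyLattice b y := by
  have : LocallyPathConnectedSpace L := ChartedSpace.locallyPathConnectedSpace E L
  filter_upwards [pathComponentIn_mem_nhds (chart_source_mem_nhds E x)] with y hy p
  obtain ⟨γ, hγ⟩ : JoinedIn (chartAt E x).source x y := hy
  refine mem_holonomyLattice_iff_of_isParallelTransport γ fun v w hvw => congrArg p ?_
  exact hvw.symm.unique <| isParallelTransport_of_forall_mem_chartAt_source x γ.symm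
    (fun t => hγ _) (chartDeriv_self_apply x _).symm

theorem mem_holonomyLattice_base_iff (hb : HasIntegralLinearHolonomy b) (p : E →L[ℝ] ℝ) :
    p ∈ holonomyLattice b x₀ ↔ ∀ i, ∃ k : ℤ, p (b i) = k := by
  refine ⟨fun hp i => hp (.refl x₀) i (b i) (isParallelTransport_refl (E := E) x₀ (b i)),
    fun hp γ i w hw => ?_⟩
  obtain ⟨A, hA⟩ := exists_linearEquiv_isParallelTransport (E := E) γ
  obtain ⟨B, hB⟩ := hb A ⟨γ, hA⟩
  choose k hk using hp
  have hcolumn : w = ∑ j, ((B : Matrix (Fin n) (Fin n) ℤ) j i : ℝ) • b j := by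
    rw [show w = A (b i) from hw.unique (hA (b i)), ← b.sum_repr (A (b i))]
    refine Finset.sum_congr rfl fun j _ => congrArg (· • b j) ?_
    exact (LinearMap.toMatrix_apply b b _ j i).symm.trans (congrFun₂ hB j i)
  refine ⟨∑ j, (B : Matrix (Fin n) (Fin n) ℤ) j i * k j, ?_⟩
  rw [hcolumn]
  push_cast
  refine (map_sum p _ _).trans (Finset.sum_congr rfl fun j _ => ?_)
  rw [← hk j]
  exact map_smul p _ _

theorem exists_holonomyLattice_eq_span [PreconnectedSpace L] (hb : HasIntegralLinearHolonomy b)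
    (x : L) : ∃ B : Module.Basis (Fin n) ℝ E,
      holonomyLattice b x = Submodule.span ℤ (range (continuousDualBasis B)) := by
  have : LocallyPathConnectedSpace L := ChartedSpace.locallyPathConnectedSpace E L
  have : ConnectedSpace L := ⟨⟨x₀⟩⟩
  have : FiniteDimensional ℝ E := b.finiteDimensional_of_finite
  have : PathConnectedSpace L := pathConnectedSpace_iff_connectedSpace.2 ‹_›
  let γ : Path x₀ x := PathConnectedSpace.somePath x₀ x
  obtain ⟨A, hA⟩ := exists_linearEquiv_isParallelTransport (E := E) γ
  refine ⟨Module.Basis.map b A, Submodule.ext fun p => ?_⟩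
  have htransport := mem_holonomyLattice_iff_of_isParallelTransport (b := b) γ
    (p := p.comp (LinearMap.toContinuousLinearMap A.toLinearMap)) (p' := p)
    fun v w hvw => congrArg p ((hA v).unique hvw)
  rw [← htransport, mem_holonomyLattice_base_iff hb, mem_span_int_continuousDualBasis_iff]
  rfl

variable (b) in
/-- The field of the lattices `holonomyLattice b x`. -/
def parallelHolonomyLattice [PreconnectedSpace L] (hb : HasIntegralLinearHolonomy b) :
    ParallelLattice E L :=
  have hdiscrete x : DiscreteTopology (holonomyLattice b x) := by
    obtain ⟨B, hB⟩ := exists_holonomyLattice_eq_span hb x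
    rw [hB]
    infer_instance
  { fiber := holonomyLattice b
    isZLattice := fun x => by
      obtain ⟨B, hB⟩ := exists_holonomyLattice_eq_span hb x
      constructor
      rw [hB]
      exact ZSpan.span_top _
    eventually_mem_iff := eventually_mem_holonomyLattice_iff b }

end HolonomyLattice

section CoordinateExpressions

variable {F F' : Type*} [NormedAddCommGroup F] [NormedSpace ℝ F] [NormedAddCommGroup F']
  [NormedSpace ℝ F'] {H H' : Type*} [TopologicalSpace H] [TopologicalSpace H']
  {I : ModelWithCorners ℝ F H} {I' : ModelWithCorners ℝ F' H'} [I.Boundaryless]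
  {N N' : Type*} [TopologicalSpace N] [ChartedSpace H N] [TopologicalSpace N'] [ChartedSpace H' N']

theorem writtenInExtChartAt_eventuallyEq {f : N → N'} {x : N} {g : F → F'}
    (h : ∀ᶠ y in 𝓝 x, extChartAt I' (f x) (f y) = g (extChartAt I x y)) :
    writtenInExtChartAt I I' x f =ᶠ[𝓝 (extChartAt I x x)] g := by
  have hsymm : Tendsto (extChartAt I x).symm (𝓝 (extChartAt I x x)) (𝓝 x) := by
    simpa only [ContinuousAt, extChartAt_to_inv] using continuousAt_extChartAt_symm (I := I) x
  filter_upwards [hsymm.eventually h, extChartAt_target_mem_nhds (I := I) x] with u hu hut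
  rw [writtenInExtChartAt, Function.comp_apply, Function.comp_apply, hu,
    (extChartAt I x).right_inv hut]

theorem hasMFDerivAt_of_eventually_extChartAt_eq {f : N → N'} {x : N} (hf : ContinuousAt f x)
    {g : F → F'} {g' : F →L[ℝ] F'} (hg : HasFDerivAt g g' (extChartAt I x x))
    (h : ∀ᶠ y in 𝓝 x, extChartAt I' (f x) (f y) = g (extChartAt I x y)) :
    HasMFDerivAt I I' f x g' :=
  ⟨hf, (hg.congr_of_eventuallyEq (writtenInExtChartAt_eventuallyEq h)).hasFDerivWithinAt⟩

theorem contMDiffAt_of_eventually_extChartAt_eq {f : N → N'} {x : N} (hf : ContinuousAt f x)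
    {n : WithTop ℕ∞} {g : F → F'} (hg : ContDiffAt ℝ n g (extChartAt I x x))
    (h : ∀ᶠ y in 𝓝 x, extChartAt I' (f x) (f y) = g (extChartAt I x y)) :
    ContMDiffAt I I' n f x :=
  contMDiffAt_iff.2
    ⟨hf, (hg.congr_of_eventuallyEq (writtenInExtChartAt_eventuallyEq h)).contDiffWithinAt⟩

theorem hasMFDerivAt_of_eventuallyEq_comp_extChartAt {f : N → F'} {x : N} {g : F → F'}
    {g' : F →L[ℝ] F'} (hg : HasFDerivAt g g' (extChartAt I x x))
    (h : f =ᶠ[𝓝 x] g ∘ extChartAt I x) : HasMFDerivAt I 𝓘(ℝ, F') f x g' :=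
  hasMFDerivAt_of_eventually_extChartAt_eq
    ((hg.continuousAt.comp (continuousAt_extChartAt x)).congr h.symm) hg h

end CoordinateExpressions

section CanonicalForm

variable {E : Type*} [NormedAddCommGroup E] [NormedSpace ℝ E]

variable (E) in
/-- The canonical symplectic form `∑ dxᵢ ∧ dpᵢ` of the phase space. -/
def canonicalForm : PhaseSpace E [⋀^Fin 2]→L[ℝ] ℝ where
  toFun v := (v 1).2 (v 0).1 - (v 0).2 (v 1).1
  map_update_add' v i x y := by
    fin_cases i <;> simp <;> ring
  map_update_smul' v i c x := by
    fin_cases i <;> simp <;> ring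
  map_eq_zero_of_eq' v i j h hij := by
    have : v 0 = v 1 := by
      fin_cases i <;> fin_cases j <;> simp_all
    rw [this, sub_self]
  cont := by fun_prop

theorem canonicalForm_apply (v w : PhaseSpace E) :
    canonicalForm E ![v, w] = w.2 v.1 - v.2 w.1 := rfl

theorem canonicalForm_cotangentLift (a : E ≃L[ℝ] E) (v w : PhaseSpace E) :
    canonicalForm E ![cotangentLift a v, cotangentLift a w] = canonicalForm E ![v, w] := by
  change w.2 (a.symm (a v.1)) - v.2 (a.symm (a w.1)) = _
  rw [a.symm_apply_apply, a.symm_apply_apply]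
  rfl

theorem canonicalForm_compContinuousLinearMap_cotangentLift (a : E ≃L[ℝ] E) :
    (canonicalForm E).compContinuousLinearMap (cotangentLift a : PhaseSpace E →L[ℝ] PhaseSpace E) =
      canonicalForm E := by
  ext v
  exact canonicalForm_cotangentLift a (v 0) (v 1)

theorem canonicalForm_nondegenerate {v : PhaseSpace E}
    (hv : ∀ w, canonicalForm E ![v, w] = 0) : v = 0 := by
  refine Prod.ext (SeparatingDual.eq_zero_of_forall_dual_eq_zero (R := ℝ) fun p => ?_)
    (ContinuousLinearMap.ext fun x => ?_)
  · simpa [canonicalForm_apply] using hv (0, p)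
  · simpa [canonicalForm_apply] using hv (x, 0)

theorem cotangentLift_symm (a : E ≃L[ℝ] E) : (cotangentLift a).symm = cotangentLift a.symm := rfl

variable (E) in
/-- The subspace `dp = 0` of the phase space. -/
def horizontalSpace : Submodule ℝ (PhaseSpace E) :=
  LinearMap.ker (LinearMap.snd ℝ E (E →L[ℝ] ℝ))

theorem cotangentLift_mem_horizontalSpace_iff (a : E ≃L[ℝ] E) (v : PhaseSpace E) :
    cotangentLift a v ∈ horizontalSpace E ↔ v ∈ horizontalSpace E :=
  (a.arrowCongr (.refl ℝ ℝ)).map_eq_zero_iff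

theorem mem_horizontalSpace_iff_forall_canonicalForm_eq_zero (v : PhaseSpace E) :
    v ∈ horizontalSpace E ↔ ∀ w ∈ horizontalSpace E, canonicalForm E ![v, w] = 0 := by
  constructor
  · intro (hv : v.2 = 0) w (hw : w.2 = 0)
    rw [canonicalForm_apply, hv, hw, zero_apply, zero_apply, sub_self]
  · intro hv
    refine ContinuousLinearMap.ext fun x => ?_
    simpa [canonicalForm_apply] using hv (x, 0) rfl

theorem finrank_horizontalSpace : Module.finrank ℝ (horizontalSpace E) = Module.finrank ℝ E := by
  rw [horizontalSpace, ← LinearMap.range_inl]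
  exact LinearMap.finrank_range_of_inj LinearMap.inl_injective

end CanonicalForm

section CotangentAtlas

variable {E : Type*} [NormedAddCommGroup E] [NormedSpace ℝ E] {H : Type*} [TopologicalSpace H]

/-- The coordinate changes of `N` are locally the compositions of cotangent lifts of linear maps
and translations, which preserve `∑ dxᵢ ∧ dpᵢ` and `dp = 0`. -/
def HasCotangentAtlas (I : ModelWithCorners ℝ (PhaseSpace E) H) (N : Type*)
    [TopologicalSpace N] [ChartedSpace H N] : Prop :=
  ∀ m m₀ : N, m₀ ∈ (extChartAt I m).source → ∃ (a : E ≃L[ℝ] E) (c : PhaseSpace E),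
    ∀ᶠ m' in 𝓝 m₀, extChartAt I m m' = cotangentLift a (extChartAt I m₀ m') + c

/-- The form `∑ dxᵢ ∧ dpᵢ` on a manifold modelled on the phase space, in the preferred chart at
each point. It is globally meaningful for a cotangent atlas. -/
def canonicalTwoForm (I : ModelWithCorners ℝ (PhaseSpace E) H) (N : Type*)
    [TopologicalSpace N] [ChartedSpace H N] : TwoForm I N := fun _ => canonicalForm E

/-- The distribution `dp = 0` on a manifold modelled on the phase space, in the preferred chart
at each point. It is globally meaningful for a cotangent atlas. -/
def horizontalDistribution (E : Type*) [NormedAddCommGroup E] [NormedSpace ℝ E] (N : Type*)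
    [TopologicalSpace N] [ChartedSpace (PhaseSpace E) N] : Distribution (PhaseSpace E) N :=
  fun _ => horizontalSpace E

variable {I : ModelWithCorners ℝ (PhaseSpace E) H} [I.Boundaryless] {N : Type*}
  [TopologicalSpace N] [ChartedSpace H N]

theorem hasFDerivAt_cotangentLift_add (a : E ≃L[ℝ] E) (c y : PhaseSpace E) :
    HasFDerivAt (fun y => cotangentLift a y + c)
      (cotangentLift a : PhaseSpace E →L[ℝ] PhaseSpace E) y :=
  (cotangentLift a).hasFDerivAt.add_const c

namespace HasCotangentAtlas

theorem hasMFDerivAt_extChartAt (h : HasCotangentAtlas I N) {m m₀ : N}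
    (hm : m₀ ∈ (extChartAt I m).source) :
    ∃ a : E ≃L[ℝ] E, HasMFDerivAt I 𝓘(ℝ, PhaseSpace E) (extChartAt I m) m₀
      (cotangentLift a : PhaseSpace E →L[ℝ] PhaseSpace E) := by
  obtain ⟨a, c, hc⟩ := h m m₀ hm
  exact ⟨a, hasMFDerivAt_of_eventuallyEq_comp_extChartAt (hasFDerivAt_cotangentLift_add a c _) hc⟩

theorem eventually_extChartAt_symm (h : HasCotangentAtlas I N) {m : N} {y : PhaseSpace E}
    (hy : y ∈ (extChartAt I m).target) :
    ∃ (a : E ≃L[ℝ] E) (c : PhaseSpace E), ∀ᶠ u in 𝓝 y,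
      extChartAt I ((extChartAt I m).symm y) ((extChartAt I m).symm u) =
        cotangentLift a u + c := by
  obtain ⟨a, c, hc⟩ := h m _ ((extChartAt I m).map_target hy)
  refine ⟨a.symm, -cotangentLift a.symm c, ?_⟩
  filter_upwards [(continuousAt_extChartAt_symm'' hy).eventually hc,
    (isOpen_extChartAt_target m).mem_nhds hy] with u hu hut
  rw [(extChartAt I m).right_inv hut] at hu
  rw [← sub_eq_add_neg, ← map_sub, ← cotangentLift_symm, ContinuousLinearEquiv.eq_symm_apply]
  exact eq_sub_of_add_eq hu.symm

theorem inChart_canonicalTwoForm (h : HasCotangentAtlas I N) {m : N} {y : PhaseSpace E}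
    (hy : y ∈ (extChartAt I m).target) :
    (canonicalTwoForm I N).inChart I m y = canonicalForm E := by
  obtain ⟨a, c, hc⟩ := h.eventually_extChartAt_symm hy
  have ha : HasMFDerivAt 𝓘(ℝ, PhaseSpace E) I (extChartAt I m).symm y
      (cotangentLift a : PhaseSpace E →L[ℝ] PhaseSpace E) :=
    hasMFDerivAt_of_eventually_extChartAt_eq (continuousAt_extChartAt_symm'' hy)
      (hasFDerivAt_cotangentLift_add a c y) hc
  rw [TwoForm.inChart, ha.mfderiv]
  exact canonicalForm_compContinuousLinearMap_cotangentLift a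

theorem mvfderiv_extChartAt_mem_horizontalSpace_iff (h : HasCotangentAtlas I N) {m m₀ : N}
    (hm : m₀ ∈ (extChartAt I m).source) (v : PhaseSpace E) :
    mvfderiv I (extChartAt I m) m₀ v ∈ horizontalSpace E ↔ v ∈ horizontalSpace E := by
  obtain ⟨a, ha⟩ := h.hasMFDerivAt_extChartAt hm
  have hv : mvfderiv I (extChartAt I m) m₀ v = cotangentLift a v := DFunLike.congr_fun ha.mfderiv v
  rw [hv, cotangentLift_mem_horizontalSpace_iff]

end HasCotangentAtlas

end CotangentAtlas

section CotangentAtlasGeometry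

variable {E : Type*} [NormedAddCommGroup E] [NormedSpace ℝ E] {N : Type*} [TopologicalSpace N]
  [ChartedSpace (PhaseSpace E) N]

namespace HasCotangentAtlas

theorem isManifold (h : HasCotangentAtlas 𝓘(ℝ, PhaseSpace E) N)
    (hatlas : ∀ e ∈ atlas (PhaseSpace E) N, ∃ m : N, e = chartAt _ m) :
    IsManifold 𝓘(ℝ, PhaseSpace E) ∞ N := by
  refine isManifold_of_contDiffOn _ _ _ fun e e' he he' u hu => ?_
  obtain ⟨m, rfl⟩ := hatlas e he
  obtain ⟨m', rfl⟩ := hatlas e' he'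
  obtain ⟨⟨hut, hus⟩, -⟩ := hu
  have hut' : u ∈ (extChartAt 𝓘(ℝ, PhaseSpace E) m).target := by
    rw [extChartAt_target]
    exact ⟨hut, mem_range_self u⟩
  obtain ⟨a, c, hc⟩ := h.eventually_extChartAt_symm hut'
  obtain ⟨a', c', hc'⟩ := h m' ((extChartAt 𝓘(ℝ, PhaseSpace E) m).symm u)
    (by rwa [extChartAt_source])
  have hsmooth : ContDiffAt ℝ ∞ (fun u => cotangentLift a' (cotangentLift a u + c) + c') u :=
    (((cotangentLift a').contDiff.comp ((cotangentLift a).contDiff.add contDiff_const)).add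
      contDiff_const).contDiffAt
  refine (hsmooth.congr_of_eventuallyEq ?_).contDiffWithinAt
  filter_upwards [hc, (continuousAt_extChartAt_symm'' hut').eventually hc'] with y hy hy'
  rw [← hy, ← hy']
  rfl

theorem isSymplectic (h : HasCotangentAtlas 𝓘(ℝ, PhaseSpace E) N) :
    IsSymplectic (canonicalTwoForm 𝓘(ℝ, PhaseSpace E) N) where
  smooth m := contDiffOn_const.congr fun _ hy => h.inChart_canonicalTwoForm hy
  closed m y hy := by
    have hconst : (canonicalTwoForm 𝓘(ℝ, PhaseSpace E) N).inChart 𝓘(ℝ, PhaseSpace E) m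
        =ᶠ[𝓝 y] fun _ => canonicalForm E :=
      ((isOpen_extChartAt_target m).eventually_mem hy).mono fun _ => h.inChart_canonicalTwoForm
    rw [hconst.extDeriv_eq]
    exact ContinuousAlternatingMap.ext fun v => by
      rw [extDeriv_apply (differentiableAt_const _)]
      simp only [fderiv_fun_const, Pi.zero_apply, zero_apply, smul_zero, Finset.sum_const_zero]
      rfl
  nondegenerate _ _ hv := canonicalForm_nondegenerate hv

theorem isFoliation [IsManifold 𝓘(ℝ, PhaseSpace E) ∞ N]
    (h : HasCotangentAtlas 𝓘(ℝ, PhaseSpace E) N) :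
    IsFoliation (Module.finrank ℝ E) (horizontalDistribution E N) := fun m₀ =>
  ⟨chartAt _ m₀, IsManifold.chart_mem_maximalAtlas m₀, mem_chart_source _ m₀,
    horizontalSpace E, finrank_horizontalSpace, fun _ hm v =>
      (h.mvfderiv_extChartAt_mem_horizontalSpace_iff (by rwa [extChartAt_source]) v).symm⟩

end HasCotangentAtlas

theorem isLagrangian_horizontalDistribution :
    IsLagrangian (canonicalTwoForm 𝓘(ℝ, PhaseSpace E) N) (horizontalDistribution E N) :=
  fun _ => mem_horizontalSpace_iff_forall_canonicalForm_eq_zero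

end CotangentAtlasGeometry

section TorusBundleGeometry

variable {E : Type v} [NormedAddCommGroup E] [NormedSpace ℝ E]
  {L : Type u} [TopologicalSpace L] [ChartedSpace E L]

section Smooth

variable [IsManifold 𝓘(ℝ, E) 1 L] {Λ : ParallelLattice E L}

instance : ChartedSpace (PhaseSpace E) (TorusBundle Λ) :=
  IsLocalHomeomorph.chartedSpace (H := ModelProd E (E →L[ℝ] ℝ))
    isLocalHomeomorph_toTorus toTorus_surjective

theorem exists_torus_extChartAt_eq (m : TorusBundle Λ) : ∃ (z : CotangentBundle E L)
    (e : OpenPartialHomeomorph (TorusBundle Λ) (CotangentBundle E L)), toTorus Λ z = m ∧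
      z ∈ e.target ∧ e.symm = toTorus Λ ∧
      (∀ m', extChartAt 𝓘(ℝ, PhaseSpace E) m m' = extChartAt 𝓘Cot(E) z (e m')) ∧
      (extChartAt 𝓘(ℝ, PhaseSpace E) m).source =
        e.source ∩ e ⁻¹' (extChartAt 𝓘Cot(E) z).source := by
  have hloc := isLocalHomeomorph_toTorus (Λ := Λ)
  have hsurj := (toTorus_surjective (Λ := Λ)).hasRightInverse
  refine ⟨hsurj.choose m, hloc.localInverseAt (hsurj.choose m), hsurj.choose_spec m,
    hloc.self_mem_localInverseAt_target, hloc.localInverseAt_symm _, fun m' => rfl, ?_⟩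
  rw [extChartAt_source, extChartAt_source]
  rfl

theorem eventually_extChartAt_toTorus (z : CotangentBundle E L) :
    ∃ c : PhaseSpace E, ∀ᶠ w in 𝓝 z,
      extChartAt 𝓘(ℝ, PhaseSpace E) (toTorus Λ z) (toTorus Λ w) =
        extChartAt 𝓘Cot(E) z w + c := by
  obtain ⟨z₀, e, hz₀, hze, he, hext, -⟩ := exists_torus_extChartAt_eq (toTorus Λ z)
  obtain ⟨τ, hτ, hτz, c, hc⟩ := exists_local_translation hz₀.symm
  refine ⟨c, ?_⟩
  filter_upwards [hc, hτ.eventually (e.open_target.mem_nhds (hτz ▸ hze))] with w hw hwe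
  rw [hext, ← hw.1, ← he, e.right_inv hwe, hw.2]

theorem hasMFDerivAt_toTorus (z : CotangentBundle E L) :
    HasMFDerivAt 𝓘Cot(E) 𝓘(ℝ, PhaseSpace E) (toTorus Λ) z (.id ℝ (PhaseSpace E)) := by
  obtain ⟨c, hc⟩ := eventually_extChartAt_toTorus (Λ := Λ) z
  exact hasMFDerivAt_of_eventually_extChartAt_eq continuous_toTorus.continuousAt
    ((hasFDerivAt_id _).add_const c) hc

theorem contMDiff_toTorus : ContMDiff 𝓘Cot(E) 𝓘(ℝ, PhaseSpace E) ∞ (toTorus Λ) := fun z => by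
  obtain ⟨c, hc⟩ := eventually_extChartAt_toTorus (Λ := Λ) z
  exact contMDiffAt_of_eventually_extChartAt_eq continuous_toTorus.continuousAt
    (contDiffAt_id.add contDiffAt_const) hc

theorem contMDiffOn_symm_of_eq_toTorus
    {e : OpenPartialHomeomorph (CotangentBundle E L) (TorusBundle Λ)} (he : toTorus Λ = e) :
    ContMDiffOn 𝓘(ℝ, PhaseSpace E) 𝓘Cot(E) ∞ e.symm e.target := by
  intro m hm
  have hinv : ∀ m' ∈ e.target, toTorus Λ (e.symm m') = m' := fun m' h => he ▸ e.right_inv h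
  obtain ⟨c, hc⟩ := eventually_extChartAt_toTorus (Λ := Λ) (e.symm m)
  rw [hinv m hm] at hc
  have hcont := e.symm.continuousAt hm
  refine (contMDiffAt_of_eventually_extChartAt_eq hcont (g := fun u => u - c)
    (contDiffAt_id.sub contDiffAt_const) ?_).contMDiffWithinAt
  filter_upwards [hcont.eventually hc, e.open_target.mem_nhds hm] with m' hm' hm't
  rw [hinv m' hm't] at hm'
  exact eq_sub_of_add_eq hm'.symm

theorem isLocalDiffeomorph_toTorus :
    IsLocalDiffeomorph 𝓘Cot(E) 𝓘(ℝ, PhaseSpace E) ∞ (toTorus Λ) := by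
  intro z
  obtain ⟨e, hze, he⟩ := isLocalHomeomorph_toTorus (Λ := Λ) z
  refine ⟨⟨e.toPartialEquiv, e.open_source, e.open_target, ?_,
    contMDiffOn_symm_of_eq_toTorus he⟩, hze, fun w _ => congr_fun he w⟩
  change ContMDiffOn 𝓘Cot(E) 𝓘(ℝ, PhaseSpace E) ∞ e e.source
  rw [← he]
  exact contMDiff_toTorus.contMDiffOn

theorem pullback_toTorus_canonicalTwoForm :
    (canonicalTwoForm 𝓘(ℝ, PhaseSpace E) (TorusBundle Λ)).pullback 𝓘(ℝ, PhaseSpace E) 𝓘Cot(E)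
      (toTorus Λ) = canonicalTwoForm 𝓘Cot(E) (CotangentBundle E L) := by
  funext z
  rw [TwoForm.pullback, (hasMFDerivAt_toTorus z).mfderiv]
  rfl

end Smooth

variable [HasGroupoid L (affineGroupoid E)]

theorem hasCotangentAtlas_cotangentBundle : HasCotangentAtlas 𝓘Cot(E) (CotangentBundle E L) :=
  fun z _ h => eventually_cotangent_extChartAt_eq (by rwa [cotangent_extChartAt_source z] at h)

variable {Λ : ParallelLattice E L}

theorem hasCotangentAtlas_torusBundle :
    HasCotangentAtlas 𝓘(ℝ, PhaseSpace E) (TorusBundle Λ) := by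
  intro m m₀ hm
  obtain ⟨z, e, -, -, he, hext, hsource⟩ := exists_torus_extChartAt_eq m
  rw [hsource] at hm
  have hinv : ∀ m' ∈ e.source, toTorus Λ (e m') = m' := fun m' h => he ▸ e.left_inv h
  obtain ⟨a, c, hc⟩ := hasCotangentAtlas_cotangentBundle z (e m₀) hm.2
  obtain ⟨c', hc'⟩ := eventually_extChartAt_toTorus (Λ := Λ) (e m₀)
  rw [hinv m₀ hm.1] at hc'
  refine ⟨a, c - cotangentLift a c', ?_⟩
  have hcont := e.continuousAt hm.1
  filter_upwards [hcont.eventually hc, hcont.eventually hc', e.open_source.mem_nhds hm.1]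
    with m' hlift htranslate hm's
  rw [hinv m' hm's] at htranslate
  rw [hext, hlift, htranslate, map_add]
  abel

instance : IsManifold 𝓘(ℝ, PhaseSpace E) ∞ (TorusBundle Λ) :=
  hasCotangentAtlas_torusBundle.isManifold <| by
    rintro e ⟨m, rfl⟩
    exact ⟨m, rfl⟩

theorem isCotangentQuotient_toTorus :
    IsCotangentQuotient (fun x => (Λ.fiber x : Set (E →L[ℝ] ℝ)))
      (canonicalTwoForm 𝓘(ℝ, PhaseSpace E) (TorusBundle Λ))
      (horizontalDistribution E (TorusBundle Λ)) (toTorus Λ) where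
  localDiffeomorph := isLocalDiffeomorph_toTorus
  surjective := toTorus_surjective
  proj_eq _ _ h := (toTorus_eq_iff.1 h).1
  eq_iff _ _ _ := toTorus_eq_iff.trans (and_iff_right rfl)
  form z y hy v w := by
    rw [pullback_toTorus_canonicalTwoForm,
      hasCotangentAtlas_cotangentBundle.inChart_canonicalTwoForm hy]
    exact canonicalForm_apply v w
  horizontal _ z' hz' v := by
    rw [(hasMFDerivAt_toTorus z').mfderiv]
    exact (hasCotangentAtlas_cotangentBundle.mvfderiv_extChartAt_mem_horizontalSpace_iff hz'
      v).symm

end TorusBundleGeometry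

section VectorFields

variable {E : Type*} [NormedAddCommGroup E] [NormedSpace ℝ E] {N : Type*} [TopologicalSpace N]
  [ChartedSpace E N]

/-- The coordinate expression of a vector field in the preferred chart at `m`. -/
def fieldInChart (m : N) (V : ∀ m : N, TangentSpace 𝓘(ℝ, E) m) : E → E :=
  VectorField.mpullbackWithin 𝓘(ℝ, E) 𝓘(ℝ, E) (extChartAt 𝓘(ℝ, E) m).symm V (range 𝓘(ℝ, E))

theorem fieldInChart_apply [IsManifold 𝓘(ℝ, E) 1 N] {m m' : N}
    (hm : m' ∈ (extChartAt 𝓘(ℝ, E) m).source) (V : ∀ m : N, TangentSpace 𝓘(ℝ, E) m) :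
    fieldInChart m V (extChartAt 𝓘(ℝ, E) m m') =
      mvfderiv 𝓘(ℝ, E) (extChartAt 𝓘(ℝ, E) m) m' (V m') := by
  let A : E →L[ℝ] E := mfderivWithin 𝓘(ℝ, E) 𝓘(ℝ, E) (extChartAt 𝓘(ℝ, E) m).symm
    (range 𝓘(ℝ, E)) (extChartAt 𝓘(ℝ, E) m m')
  let B : E →L[ℝ] E := mfderiv 𝓘(ℝ, E) 𝓘(ℝ, E) (extChartAt 𝓘(ℝ, E) m) m'
  have hinv : A.inverse = B := ContinuousLinearMap.inverse_eq
    (mfderivWithin_extChartAt_symm_comp_mfderiv_extChartAt' hm)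
    (mfderiv_extChartAt_comp_mfderivWithin_extChartAt_symm' hm)
  let V' : N → E := V
  change A.inverse (V' ((extChartAt 𝓘(ℝ, E) m).symm (extChartAt 𝓘(ℝ, E) m m'))) = B (V' m')
  rw [hinv, (extChartAt 𝓘(ℝ, E) m).left_inv hm]

theorem fieldInChart_self [IsManifold 𝓘(ℝ, E) 1 N] (m : N)
    (V : ∀ m : N, TangentSpace 𝓘(ℝ, E) m) :
    fieldInChart m V (extChartAt 𝓘(ℝ, E) m m) = V m := by
  rw [fieldInChart_apply (mem_extChartAt_source m)]
  change mfderiv 𝓘(ℝ, E) 𝓘(ℝ, E) (extChartAt 𝓘(ℝ, E) m) m (V m) = V m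
  rw [mfderiv_extChartAt_self]
  rfl

theorem differentiableAt_fieldInChart [CompleteSpace E] [IsManifold 𝓘(ℝ, E) ∞ N] (m : N)
    {V : ∀ m : N, TangentSpace 𝓘(ℝ, E) m} (hV : IsSmoothField V) :
    DifferentiableAt ℝ (fieldInChart m V) (extChartAt 𝓘(ℝ, E) m m) := by
  have hsmooth := VectorField.contMDiffWithinAt_mpullbackWithin_extChartAt_symm (m := 1) (n := ∞)
    ((hV m).of_le (by norm_cast)).contMDiffWithinAt uniqueMDiffOn_univ (mem_univ m)
    (by norm_cast)
  rw [contMDiffWithinAt_vectorSpace_iff_contDiffWithinAt, preimage_univ, inter_univ] at hsmooth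
  exact (hsmooth.contDiffAt (extChartAt_target_mem_nhds m)).differentiableAt one_ne_zero

theorem mlieBracket_eq_fderiv_sub_fderiv [IsManifold 𝓘(ℝ, E) 1 N] (m : N)
    (V W : ∀ m : N, TangentSpace 𝓘(ℝ, E) m) :
    VectorField.mlieBracket 𝓘(ℝ, E) V W m =
      fderiv ℝ (fieldInChart m W) (extChartAt 𝓘(ℝ, E) m m) (V m) -
        fderiv ℝ (fieldInChart m V) (extChartAt 𝓘(ℝ, E) m m) (W m) := by
  let B : E →L[ℝ] E := mfderiv 𝓘(ℝ, E) 𝓘(ℝ, E) (extChartAt 𝓘(ℝ, E) m) m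
  have hB : B = .id ℝ E := mfderiv_extChartAt_self
  change B.inverse (VectorField.lieBracketWithin ℝ (fieldInChart m V) (fieldInChart m W)
    (univ ∩ range 𝓘(ℝ, E)) (extChartAt 𝓘(ℝ, E) m m)) = _
  rw [hB, ContinuousLinearMap.inverse_id, univ_inter, modelWithCornersSelf_coe, range_id,
    VectorField.lieBracketWithin_univ]
  change fderiv ℝ (fieldInChart m W) _ (fieldInChart m V _) -
    fderiv ℝ (fieldInChart m V) _ (fieldInChart m W _) = _
  rw [fieldInChart_self, fieldInChart_self]

end VectorFields

section WeinsteinFormula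

variable {E : Type*} [NormedAddCommGroup E] [NormedSpace ℝ E] {N : Type*} [TopologicalSpace N]
  [ChartedSpace (PhaseSpace E) N]

namespace HasCotangentAtlas

theorem canonicalForm_fieldInChart [IsManifold 𝓘(ℝ, PhaseSpace E) 1 N]
    (h : HasCotangentAtlas 𝓘(ℝ, PhaseSpace E) N) {m m' : N}
    (hm : m' ∈ (extChartAt 𝓘(ℝ, PhaseSpace E) m).source)
    (V W : ∀ m : N, TangentSpace 𝓘(ℝ, PhaseSpace E) m) :
    canonicalForm E ![fieldInChart m V (extChartAt 𝓘(ℝ, PhaseSpace E) m m'),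
        fieldInChart m W (extChartAt 𝓘(ℝ, PhaseSpace E) m m')] =
      canonicalTwoForm 𝓘(ℝ, PhaseSpace E) N m' ![V m', W m'] := by
  obtain ⟨a, ha⟩ := h.hasMFDerivAt_extChartAt hm
  rw [fieldInChart_apply hm, fieldInChart_apply hm, mvfderiv, ha.mfderiv]
  exact canonicalForm_cotangentLift a (V m') (W m')

theorem fieldInChart_snd_eq_zero [IsManifold 𝓘(ℝ, PhaseSpace E) 1 N]
    (h : HasCotangentAtlas 𝓘(ℝ, PhaseSpace E) N) {m m' : N}
    (hm : m' ∈ (extChartAt 𝓘(ℝ, PhaseSpace E) m).source)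
    {V : ∀ m : N, TangentSpace 𝓘(ℝ, PhaseSpace E) m}
    (hV : ∀ m, V m ∈ horizontalDistribution E N m) :
    (fieldInChart m V (extChartAt 𝓘(ℝ, PhaseSpace E) m m')).2 = 0 := by
  rw [fieldInChart_apply hm]
  exact (h.mvfderiv_extChartAt_mem_horizontalSpace_iff hm (V m')).2 (hV m')

variable [CompleteSpace E] [IsManifold 𝓘(ℝ, PhaseSpace E) ∞ N]

theorem fderiv_fieldInChart_snd_eq_zero (h : HasCotangentAtlas 𝓘(ℝ, PhaseSpace E) N)
    {V : ∀ m : N, TangentSpace 𝓘(ℝ, PhaseSpace E) m} (hV : IsSmoothField V)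
    (hVD : ∀ m, V m ∈ horizontalDistribution E N m) (m : N) (v : PhaseSpace E) :
    (fderiv ℝ (fieldInChart m V) (extChartAt 𝓘(ℝ, PhaseSpace E) m m) v).2 = 0 := by
  set ψ := extChartAt 𝓘(ℝ, PhaseSpace E) m
  have hzero : (fun u => (fieldInChart m V u).2) =ᶠ[𝓝 (ψ m)] fun _ => 0 := by
    filter_upwards [extChartAt_target_mem_nhds m] with u hu
    rw [← ψ.right_inv hu]
    exact h.fieldInChart_snd_eq_zero (ψ.map_target hu) hVD
  exact DFunLike.congr_fun ((differentiableAt_fieldInChart m hV).hasFDerivAt.snd.unique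
    ((hasFDerivAt_const 0 _).congr_of_eventuallyEq hzero)) v

theorem mvfderiv_canonicalTwoForm (h : HasCotangentAtlas 𝓘(ℝ, PhaseSpace E) N)
    {Y Z : ∀ m : N, TangentSpace 𝓘(ℝ, PhaseSpace E) m}
    (hY : IsSmoothField Y) (hZ : IsSmoothField Z) (m : N) (v : PhaseSpace E) :
    mvfderiv 𝓘(ℝ, PhaseSpace E)
        (fun m => canonicalTwoForm 𝓘(ℝ, PhaseSpace E) N m ![Y m, Z m]) m v =
      canonicalForm E
          ![fderiv ℝ (fieldInChart m Y) (extChartAt 𝓘(ℝ, PhaseSpace E) m m) v, Z m] +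
        canonicalForm E
          ![Y m, fderiv ℝ (fieldInChart m Z) (extChartAt 𝓘(ℝ, PhaseSpace E) m m) v] := by
  have hfY := (differentiableAt_fieldInChart m hY).hasFDerivAt
  have hfZ := (differentiableAt_fieldInChart m hZ).hasFDerivAt
  have hcoord : (fun m => canonicalTwoForm 𝓘(ℝ, PhaseSpace E) N m ![Y m, Z m]) =ᶠ[𝓝 m]
      (fun u => (fieldInChart m Z u).2 (fieldInChart m Y u).1 -
        (fieldInChart m Y u).2 (fieldInChart m Z u).1) ∘ extChartAt 𝓘(ℝ, PhaseSpace E) m := by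
    filter_upwards [extChartAt_source_mem_nhds (I := 𝓘(ℝ, PhaseSpace E)) m] with m' hm'
    exact (h.canonicalForm_fieldInChart hm' Y Z).symm
  have hderiv : mvfderiv 𝓘(ℝ, PhaseSpace E)
      (fun m => canonicalTwoForm 𝓘(ℝ, PhaseSpace E) N m ![Y m, Z m]) m v = _ :=
    DFunLike.congr_fun (hasMFDerivAt_of_eventuallyEq_comp_extChartAt
      ((hfZ.snd.clm_apply hfY.fst).sub (hfY.snd.clm_apply hfZ.fst)) hcoord).mfderiv v
  rw [fieldInChart_self, fieldInChart_self] at hderiv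
  have hLeibniz : ∀ y z dy dz : PhaseSpace E,
      z.2 dy.1 + dz.2 y.1 - (y.2 dz.1 + dy.2 z.1) =
        canonicalForm E ![dy, z] + canonicalForm E ![y, dz] := fun y z dy dz => by
    rw [canonicalForm_apply, canonicalForm_apply]
    ring
  exact hderiv.trans (hLeibniz (Y m) (Z m) _ _)

theorem canonicalForm_mlieBracket (h : HasCotangentAtlas 𝓘(ℝ, PhaseSpace E) N)
    {X : ∀ m : N, TangentSpace 𝓘(ℝ, PhaseSpace E) m} (hX : IsSmoothField X)
    (hXD : ∀ m, X m ∈ horizontalDistribution E N m)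
    (Z : ∀ m : N, TangentSpace 𝓘(ℝ, PhaseSpace E) m) (m : N) {y : PhaseSpace E}
    (hy : y ∈ horizontalSpace E) :
    canonicalForm E ![y, VectorField.mlieBracket 𝓘(ℝ, PhaseSpace E) X Z m] =
      canonicalForm E
        ![y, fderiv ℝ (fieldInChart m Z) (extChartAt 𝓘(ℝ, PhaseSpace E) m m) (X m)] := by
  have hsub : ∀ w w' : PhaseSpace E, w'.2 = 0 →
      canonicalForm E ![y, w - w'] = canonicalForm E ![y, w] := fun w w' hw' => by
    have hy' : y.2 = 0 := hy
    rw [canonicalForm_apply, canonicalForm_apply, Prod.snd_sub, hw', sub_zero, hy']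
    rfl
  rw [mlieBracket_eq_fderiv_sub_fderiv]
  exact hsub _ _ (h.fderiv_fieldInChart_snd_eq_zero hX hXD m (Z m))

theorem weinstein_formula (h : HasCotangentAtlas 𝓘(ℝ, PhaseSpace E) N)
    {X Y Z : ∀ m : N, TangentSpace 𝓘(ℝ, PhaseSpace E) m}
    (hX : IsSmoothField X) (hY : IsSmoothField Y) (hZ : IsSmoothField Z)
    (hXD : ∀ m, X m ∈ horizontalDistribution E N m)
    (hYD : ∀ m, Y m ∈ horizontalDistribution E N m) (m : N) :
    mvfderiv 𝓘(ℝ, PhaseSpace E)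
          (fun m => canonicalTwoForm 𝓘(ℝ, PhaseSpace E) N m ![Y m, Z m]) m (X m) -
        canonicalTwoForm 𝓘(ℝ, PhaseSpace E) N m
          ![Y m, VectorField.mlieBracket 𝓘(ℝ, PhaseSpace E) X Z m] =
      canonicalForm E
        ![fderiv ℝ (fieldInChart m Y) (extChartAt 𝓘(ℝ, PhaseSpace E) m m) (X m), Z m] :=
  (congrArg₂ _ (h.mvfderiv_canonicalTwoForm hY hZ m (X m))
    (h.canonicalForm_mlieBracket hX hXD Z m (hYD m))).trans (add_sub_cancel_right _ _)

end HasCotangentAtlas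

end WeinsteinFormula

section ZeroSection

variable {E : Type v} [NormedAddCommGroup E] [NormedSpace ℝ E]
  {L : Type u} [TopologicalSpace L] [ChartedSpace E L] [HasGroupoid L (affineGroupoid E)]

theorem exists_mem_nhds_forall_exists_smooth_curve (x : L) : ∃ U ∈ 𝓝 x, ∀ y ∈ U, ∀ y' ∈ U,
    ∃ γ : ℝ → L, ContMDiff 𝓘(ℝ, ℝ) 𝓘(ℝ, E) ∞ γ ∧ γ 0 = y ∧ γ 1 = y' := by
  set φ := extChartAt 𝓘(ℝ, E) x
  obtain ⟨r, hr, hball⟩ := Metric.mem_nhds_iff.1 (extChartAt_target_mem_nhds (I := 𝓘(ℝ, E)) x)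
  refine ⟨φ.source ∩ φ ⁻¹' Metric.ball (φ x) r, inter_mem (extChartAt_source_mem_nhds x)
    ((continuousAt_extChartAt x).preimage_mem_nhds (Metric.ball_mem_nhds _ hr)), ?_⟩
  rintro y ⟨hys, hy⟩ y' ⟨hys', hy'⟩
  let segment : ℝ → E := fun t => φ y + Real.smoothTransition t • (φ y' - φ y)
  have hsmooth : ContDiff ℝ ∞ segment :=
    contDiff_const.add (Real.smoothTransition.contDiff.smul contDiff_const)
  have hmem : ∀ t, segment t ∈ φ.target := fun t =>
    hball ((convex_ball _ r).add_smul_sub_mem hy hy'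
      ⟨Real.smoothTransition.nonneg t, Real.smoothTransition.le_one t⟩)
  refine ⟨φ.symm ∘ segment,
    (contMDiffOn_extChartAt_symm x).comp_contMDiff hsmooth.contMDiff hmem, ?_, ?_⟩
  · simp only [Function.comp_apply, segment, Real.smoothTransition.zero, zero_smul, add_zero]
    exact φ.left_inv hys
  · simp only [Function.comp_apply, segment, Real.smoothTransition.one, one_smul,
      add_sub_cancel]
    exact φ.left_inv hys'

theorem continuous_cotangent_zero : Continuous (fun x : L => (⟨x, 0⟩ : CotangentBundle E L)) :=
  (Bundle.contMDiff_zeroSection (n := ∞) (IB := 𝓘(ℝ, E)) ℝ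
    (fun x : L => TangentSpace 𝓘(ℝ, E) x →L[ℝ] ℝ)).continuous

variable {Λ : ParallelLattice E L}

variable (Λ) in
/-- The zero section of the torus bundle. -/
def torusZero (x : L) : TorusBundle Λ := toTorus Λ ⟨x, 0⟩

theorem injective_torusZero : Function.Injective (torusZero Λ) :=
  fun _ _ h => (toTorus_eq_iff.1 h).1

theorem continuous_torusZero : Continuous (torusZero Λ) :=
  continuous_toTorus.comp continuous_cotangent_zero

theorem eventually_extChartAt_torusZero (x : L) : ∃ c : PhaseSpace E, ∀ᶠ y in 𝓝 x,
    extChartAt 𝓘(ℝ, PhaseSpace E) (torusZero Λ x) (torusZero Λ y) =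
      ContinuousLinearMap.inl ℝ E (E →L[ℝ] ℝ) (extChartAt 𝓘(ℝ, E) x y) + c := by
  let zero : L → CotangentBundle E L := fun x => ⟨x, 0⟩
  have hzero : Continuous zero := continuous_cotangent_zero
  obtain ⟨c, hc⟩ := eventually_extChartAt_toTorus (Λ := Λ) (zero x)
  refine ⟨c, ?_⟩
  filter_upwards [hzero.continuousAt.eventually hc, chart_source_mem_nhds E x] with y hy hyx
  refine hy.trans ?_
  rw [cotangent_extChartAt_apply (zero x) (zero y) hyx]
  congr 1

theorem hasFDerivAt_inl_add (c : PhaseSpace E) (u : E) :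
    HasFDerivAt (fun u => ContinuousLinearMap.inl ℝ E (E →L[ℝ] ℝ) u + c)
      (ContinuousLinearMap.inl ℝ E (E →L[ℝ] ℝ)) u :=
  (ContinuousLinearMap.inl ℝ E (E →L[ℝ] ℝ)).hasFDerivAt.add_const c

theorem hasMFDerivAt_torusZero (x : L) :
    HasMFDerivAt 𝓘(ℝ, E) 𝓘(ℝ, PhaseSpace E) (torusZero Λ) x
      (ContinuousLinearMap.inl ℝ E (E →L[ℝ] ℝ)) := by
  obtain ⟨c, hc⟩ := eventually_extChartAt_torusZero (Λ := Λ) x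
  exact hasMFDerivAt_of_eventually_extChartAt_eq continuous_torusZero.continuousAt
    (hasFDerivAt_inl_add c _) hc

theorem mfderiv_torusZero (x : L) (v : E) :
    mfderiv 𝓘(ℝ, E) 𝓘(ℝ, PhaseSpace E) (torusZero Λ) x v = ((v, 0) : PhaseSpace E) :=
  DFunLike.congr_fun (hasMFDerivAt_torusZero x).mfderiv v

theorem contMDiff_torusZero : ContMDiff 𝓘(ℝ, E) 𝓘(ℝ, PhaseSpace E) ∞ (torusZero Λ) := fun x => by
  obtain ⟨c, hc⟩ := eventually_extChartAt_torusZero (Λ := Λ) x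
  exact contMDiffAt_of_eventually_extChartAt_eq continuous_torusZero.continuousAt
    ((ContinuousLinearMap.inl ℝ E (E →L[ℝ] ℝ)).contDiff.add contDiff_const).contDiffAt hc

theorem tangentJoined_torusZero {γ : ℝ → L} (hγ : ContMDiff 𝓘(ℝ, ℝ) 𝓘(ℝ, E) ∞ γ) :
    TangentJoined (horizontalDistribution E (TorusBundle Λ)) (torusZero Λ (γ 0))
      (torusZero Λ (γ 1)) := by
  refine ⟨torusZero Λ ∘ γ, contMDiff_torusZero.comp hγ, rfl, rfl, fun t => ?_⟩
  rw [((hasMFDerivAt_torusZero (γ t)).comp t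
    ((hγ t).mdifferentiableAt (by simp)).hasMFDerivAt).mfderiv]
  rfl

theorem range_torusZero_subset_leafThrough [PreconnectedSpace L] (x : L) :
    range (torusZero Λ) ⊆
      leafThrough (horizontalDistribution E (TorusBundle Λ)) (torusZero Λ x) := by
  rintro _ ⟨y, rfl⟩
  refine (iff_of_forall_eventually_iff (P := fun y => torusZero Λ y ∈
    leafThrough (horizontalDistribution E (TorusBundle Λ)) (torusZero Λ x))
    (fun y => ?_) x y).1 Relation.ReflTransGen.refl
  obtain ⟨U, hU, hcurve⟩ := exists_mem_nhds_forall_exists_smooth_curve (E := E) y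
  have hjoined : ∀ z ∈ U, ∀ z' ∈ U, TangentJoined (horizontalDistribution E (TorusBundle Λ))
      (torusZero Λ z) (torusZero Λ z') := by
    intro z hz z' hz'
    obtain ⟨γ, hγ, rfl, rfl⟩ := hcurve z hz z' hz'
    exact tangentJoined_torusZero hγ
  filter_upwards [hU] with y' hy'
  exact ⟨fun h => Relation.ReflTransGen.tail h (hjoined y' hy' y (mem_of_mem_nhds hU)),
    fun h => Relation.ReflTransGen.tail h (hjoined y (mem_of_mem_nhds hU) y' hy')⟩

theorem toTorus_mem_range_torusZero_iff (z : CotangentBundle E L) :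
    toTorus Λ z ∈ range (torusZero Λ) ↔ covector z ∈ Λ.fiber z.proj := by
  have hsub : covector z - covector (⟨z.proj, 0⟩ : CotangentBundle E L) = covector z :=
    sub_zero (covector z)
  constructor
  · rintro ⟨x, hx⟩
    obtain ⟨rfl, hmem⟩ := toTorus_eq_iff.1 hx.symm
    rwa [hsub] at hmem
  · refine fun h => ⟨z.proj, (toTorus_eq_iff (z := z) (w := ⟨z.proj, 0⟩).2 ⟨rfl, ?_⟩).symm⟩
    rwa [hsub]

-- A covector of constant momentum is carried along parallel to itself, and so is the lattice.
theorem eventually_mem_range_torusZero_iff (m : TorusBundle Λ) : ∀ᶠ m' in 𝓝 m,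
    (extChartAt 𝓘(ℝ, PhaseSpace E) m m').2 = (extChartAt 𝓘(ℝ, PhaseSpace E) m m).2 →
      (m' ∈ range (torusZero Λ) ↔ m ∈ range (torusZero Λ)) := by
  obtain ⟨z, rfl⟩ := toTorus_surjective m
  obtain ⟨c, hc⟩ := eventually_extChartAt_toTorus (Λ := Λ) z
  have hproj : Tendsto TotalSpace.proj (𝓝 z) (𝓝 z.proj) := continuous_cotangent_proj.continuousAt
  rw [← isOpenQuotientMap_toTorus.isOpenMap.map_nhds_eq continuous_toTorus.continuousAt,
    eventually_map]
  filter_upwards [hc, hproj.eventually (Λ.eventually_mem_iff z.proj),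
    hproj.eventually (chart_source_mem_nhds E z.proj)] with w hw hmem hwz hmomentum
  rw [hw, hc.self_of_nhds, cotangent_extChartAt_apply z w hwz,
    cotangent_extChartAt_self] at hmomentum
  have hcovector : (covector w).comp (chartDerivSymm z.proj w.proj) = covector z :=
    add_right_cancel hmomentum
  rw [toTorus_mem_range_torusZero_iff, toTorus_mem_range_torusZero_iff, hmem, ← hcovector,
    ContinuousLinearMap.comp_assoc, chartDerivSymm_comp hwz, ContinuousLinearMap.comp_id]

theorem HasCotangentAtlas.eventually_momentum_eq {N : Type*} [TopologicalSpace N]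
    [ChartedSpace (PhaseSpace E) N] (h : HasCotangentAtlas 𝓘(ℝ, PhaseSpace E) N) {γ : ℝ → N}
    (hγ : MDifferentiable 𝓘(ℝ, ℝ) 𝓘(ℝ, PhaseSpace E) γ)
    (hD : ∀ t, mfderiv 𝓘(ℝ, ℝ) 𝓘(ℝ, PhaseSpace E) γ t (1 : ℝ) ∈ horizontalDistribution E N (γ t))
    (t₀ : ℝ) : ∀ᶠ t in 𝓝 t₀, (extChartAt 𝓘(ℝ, PhaseSpace E) (γ t₀) (γ t)).2 =
      (extChartAt 𝓘(ℝ, PhaseSpace E) (γ t₀) (γ t₀)).2 := by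
  set ψ := extChartAt 𝓘(ℝ, PhaseSpace E) (γ t₀)
  obtain ⟨r, hr, hball⟩ := Metric.eventually_nhds_iff_ball.1 <|
    (hγ t₀).continuousAt.eventually (extChartAt_source_mem_nhds (I := 𝓘(ℝ, PhaseSpace E)) (γ t₀))
  have hderiv : ∀ t ∈ Metric.ball t₀ r, HasFDerivAt (fun t => (ψ (γ t)).2)
      (0 : ℝ →L[ℝ] (E →L[ℝ] ℝ)) t := by
    intro t ht
    obtain ⟨a, ha⟩ := h.hasMFDerivAt_extChartAt (hball t ht)
    refine (ha.comp t (hγ t).hasMFDerivAt).hasFDerivAt.snd.congr_fderiv ?_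
    ext1
    exact (cotangentLift_mem_horizontalSpace_iff a _).2 (hD t)
  filter_upwards [Metric.ball_mem_nhds t₀ hr] with t ht
  exact Metric.isOpen_ball.is_const_of_fderiv_eq_zero (𝕜 := ℝ) (convex_ball t₀ r).isPreconnected
    (fun s hs => (hderiv s hs).differentiableAt.differentiableWithinAt)
    (fun s hs => (hderiv s hs).fderiv) ht (Metric.mem_ball_self hr)

theorem mem_range_torusZero_of_tangentJoined {m m' : TorusBundle Λ}
    (h : TangentJoined (horizontalDistribution E (TorusBundle Λ)) m m')
    (hm : m ∈ range (torusZero Λ)) : m' ∈ range (torusZero Λ) := by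
  obtain ⟨γ, hγ, rfl, rfl, hD⟩ := h
  refine (iff_of_forall_eventually_iff (P := fun t => γ t ∈ range (torusZero Λ))
    (fun t₀ => ?_) 0 1).1 hm
  filter_upwards [hγ.continuous.continuousAt.eventually (eventually_mem_range_torusZero_iff (γ t₀)),
    hasCotangentAtlas_torusBundle.eventually_momentum_eq (hγ.mdifferentiable (by simp)) hD t₀]
    with t hiff hmomentum
  exact hiff hmomentum

theorem isLeaf_torusZero [PreconnectedSpace L] :
    IsLeaf (E := E) (horizontalDistribution E (TorusBundle Λ)) (torusZero Λ) where
  smooth := contMDiff_torusZero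
  injective := injective_torusZero
  immersion x v w h := congrArg Prod.fst <|
    (mfderiv_torusZero (E := E) (Λ := Λ) x v).symm.trans
      (h.trans (mfderiv_torusZero (E := E) x w))
  tangent x v := by
    constructor
    · intro (hv : v.2 = 0)
      exact ⟨v.1, (mfderiv_torusZero (E := E) x v.1).trans (Prod.ext rfl hv.symm)⟩
    · rintro ⟨ξ, rfl⟩
      exact congrArg Prod.snd (mfderiv_torusZero (E := E) (Λ := Λ) x ξ)
  range_eq x := by
    refine (range_torusZero_subset_leafThrough x).antisymm
      fun m (hm : Relation.ReflTransGen _ _ m) => ?_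
    induction hm with
    | refl => exact mem_range_self x
    | tail _ h ih => exact mem_range_torusZero_of_tangentJoined h ih

end ZeroSection

section WeinsteinConnection

variable {E : Type v} [NormedAddCommGroup E] [NormedSpace ℝ E]
  {L : Type u} [TopologicalSpace L] [ChartedSpace E L] [HasGroupoid L (affineGroupoid E)]
  {Λ : ParallelLattice E L}

theorem eventually_mvfderiv_extChartAt_torusZero (x : L) : ∀ᶠ y in 𝓝 x, ∀ v : E,
    mvfderiv 𝓘(ℝ, PhaseSpace E) (extChartAt 𝓘(ℝ, PhaseSpace E) (torusZero Λ x)) (torusZero Λ y)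
        (mfderiv 𝓘(ℝ, E) 𝓘(ℝ, PhaseSpace E) (torusZero Λ) y v) =
      ((mvfderiv 𝓘(ℝ, E) (extChartAt 𝓘(ℝ, E) x) y v, 0) : PhaseSpace E) := by
  obtain ⟨c, hc⟩ := eventually_extChartAt_torusZero (Λ := Λ) x
  filter_upwards [hc.eventually_nhds, chart_source_mem_nhds E x,
    continuous_torusZero.continuousAt.eventually
      (extChartAt_source_mem_nhds (I := 𝓘(ℝ, PhaseSpace E)) (torusZero Λ x))] with y hy hyx hyψ v
  rw [extChartAt_source] at hyψ
  have hcomp := (mdifferentiableAt_extChartAt (I := 𝓘(ℝ, PhaseSpace E)) hyψ).hasMFDerivAt.comp y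
    (contMDiff_torusZero.mdifferentiable (by simp) y).hasMFDerivAt
  have hcoord := ((hasFDerivAt_inl_add c _).hasMFDerivAt.comp y
    (mdifferentiableAt_extChartAt (I := 𝓘(ℝ, E)) hyx).hasMFDerivAt).congr_of_eventuallyEq hy
  exact DFunLike.congr_fun (hasMFDerivAt_unique hcomp hcoord) v

variable [CompleteSpace E]

theorem flatConnection_eq_fderiv_fieldInChart
    {Y : ∀ m : TorusBundle Λ, TangentSpace 𝓘(ℝ, PhaseSpace E) m} (hY : IsSmoothField Y)
    {η : ∀ x : L, TangentSpace 𝓘(ℝ, E) x}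
    (hη : ∀ x, mfderiv 𝓘(ℝ, E) 𝓘(ℝ, PhaseSpace E) (torusZero Λ) x (η x) = Y (torusZero Λ x))
    (x : L) (v : E) :
    flatConnection E η x v =
      (fderiv ℝ (fieldInChart (torusZero Λ x) Y)
        (extChartAt 𝓘(ℝ, PhaseSpace E) (torusZero Λ x) (torusZero Λ x)) (v, 0)).1 := by
  obtain ⟨c, hc⟩ := eventually_extChartAt_torusZero (Λ := Λ) x
  have hcoord : (fun y => mvfderiv 𝓘(ℝ, E) (extChartAt 𝓘(ℝ, E) x) y (η y)) =ᶠ[𝓝 x]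
      (fun u => (fieldInChart (torusZero Λ x) Y
        (ContinuousLinearMap.inl ℝ E (E →L[ℝ] ℝ) u + c)).1) ∘ extChartAt 𝓘(ℝ, E) x := by
    filter_upwards [hc, eventually_mvfderiv_extChartAt_torusZero (Λ := Λ) x,
      continuous_torusZero.continuousAt.eventually
        (extChartAt_source_mem_nhds (I := 𝓘(ℝ, PhaseSpace E)) (torusZero Λ x))] with y hy hyη hyψ
    rw [Function.comp_apply, ← hy, fieldInChart_apply hyψ, ← hη]
    exact congrArg Prod.fst (hyη (η y)).symm
  have hfield := (differentiableAt_fieldInChart (torusZero Λ x) hY).hasFDerivAt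
  rw [hc.self_of_nhds] at hfield ⊢
  have hderiv := hasMFDerivAt_of_eventuallyEq_comp_extChartAt
    (hfield.comp (extChartAt 𝓘(ℝ, E) x x) (hasFDerivAt_inl_add c _)).fst hcoord
  let B : E →L[ℝ] E := mfderiv 𝓘(ℝ, E) 𝓘(ℝ, E) (extChartAt 𝓘(ℝ, E) x) x
  have hB : B = .id ℝ E := mfderiv_extChartAt_self
  change B.inverse _ = _
  rw [hB, ContinuousLinearMap.inverse_id]
  exact DFunLike.congr_fun hderiv.mfderiv v

theorem mfderiv_torusZero_flatConnection
    {Y : ∀ m : TorusBundle Λ, TangentSpace 𝓘(ℝ, PhaseSpace E) m} (hY : IsSmoothField Y)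
    (hYD : ∀ m, Y m ∈ horizontalDistribution E (TorusBundle Λ) m)
    {η : ∀ x : L, TangentSpace 𝓘(ℝ, E) x}
    (hη : ∀ x, mfderiv 𝓘(ℝ, E) 𝓘(ℝ, PhaseSpace E) (torusZero Λ) x (η x) = Y (torusZero Λ x))
    (x : L) (v : E) :
    mfderiv 𝓘(ℝ, E) 𝓘(ℝ, PhaseSpace E) (torusZero Λ) x (flatConnection E η x v) =
      fderiv ℝ (fieldInChart (torusZero Λ x) Y)
        (extChartAt 𝓘(ℝ, PhaseSpace E) (torusZero Λ x) (torusZero Λ x))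
        (mfderiv 𝓘(ℝ, E) 𝓘(ℝ, PhaseSpace E) (torusZero Λ) x v) :=
  (mfderiv_torusZero (E := E) x _).trans <| (Prod.ext
    (flatConnection_eq_fderiv_fieldInChart hY hη x v)
    (hasCotangentAtlas_torusBundle.fderiv_fieldInChart_snd_eq_zero hY hYD _ _).symm).trans <|
    congrArg _ (mfderiv_torusZero (E := E) x v).symm

theorem isWeinsteinConnection_torusZero :
    IsWeinsteinConnection (E := E) (canonicalTwoForm 𝓘(ℝ, PhaseSpace E) (TorusBundle Λ))
      (horizontalDistribution E (TorusBundle Λ)) (torusZero Λ) := by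
  intro X Y Z hX hY hZ hXD hYD ξ η hξ hη x
  rw [hasCotangentAtlas_torusBundle.weinstein_formula hX hY hZ hXD hYD, ← hξ x]
  exact congrArg (fun w : PhaseSpace E => canonicalForm E ![w, Z (torusZero Λ x)])
    (mfderiv_torusZero_flatConnection hY hYD hη x (ξ x))

end WeinsteinConnection

end LagrangianLeaf

end

theorem proposition2p4_general (n : ℕ) (E : Type v) [NormedAddCommGroup E] [NormedSpace ℝ E]
    (L : Type u) [TopologicalSpace L] [ChartedSpace E L] [HasGroupoid L (affineGroupoid E)]
    [PreconnectedSpace L] (x₀ : L) (b : Module.Basis (Fin n) ℝ (TangentSpace 𝓘(ℝ, E) x₀))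
    (hb : HasIntegralLinearHolonomy b) :
    ∃ (M : Type (max u v)) (_ : TopologicalSpace M) (_ : ChartedSpace (E × (E →L[ℝ] ℝ)) M)
      (_ : IsManifold 𝓘(ℝ, E × (E →L[ℝ] ℝ)) ∞ M)
      (_ : T2Space L → T2Space M) (_ : CompactSpace L → CompactSpace M)
      (σ : TwoForm 𝓘(ℝ, E × (E →L[ℝ] ℝ)) M) (D : Distribution (E × (E →L[ℝ] ℝ)) M)
      (q : CotangentBundle E L → M),
      IsSymplectic σ ∧ IsFoliation n D ∧ IsLagrangian σ D ∧
      IsLeaf (E := E) D (fun x : L => q ⟨x, 0⟩) ∧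
      IsWeinsteinConnection (E := E) σ D (fun x : L => q ⟨x, 0⟩) ∧
      IsCotangentQuotient (cotangentLattice b) σ D q := by
  have : FiniteDimensional ℝ E := b.finiteDimensional_of_finite
  have : CompleteSpace E := FiniteDimensional.complete ℝ E
  have hn : Module.finrank ℝ E = n :=
    (Module.finrank_eq_card_basis b).trans (Fintype.card_fin n)
  let Λ : ParallelLattice E L := parallelHolonomyLattice b hb
  exact ⟨TorusBundle Λ, inferInstance, inferInstance, inferInstance, fun _ => inferInstance,
    fun _ => inferInstance, canonicalTwoForm _ _, horizontalDistribution _ _, toTorus Λ,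
    hasCotangentAtlas_torusBundle.isSymplectic, hn ▸ hasCotangentAtlas_torusBundle.isFoliation,
    isLagrangian_horizontalDistribution, isLeaf_torusZero, isWeinsteinConnection_torusZero,
    isCotangentQuotient_toTorus (Λ := Λ)⟩

theorem proposition2p4 (n : ℕ) (L : Type u) [TopologicalSpace L]
    [ChartedSpace (EuclideanSpace ℝ (Fin n)) L]
    [HasGroupoid L (affineGroupoid (EuclideanSpace ℝ (Fin n)))]
    [T2Space L] [CompactSpace L] [ConnectedSpace L]
    (x₀ : L)
    (b : Module.Basis (Fin n) ℝ (TangentSpace 𝓘(ℝ, EuclideanSpace ℝ (Fin n)) x₀))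
    (hb : HasIntegralLinearHolonomy b) :
    ∃ (M : Type u) (_ : TopologicalSpace M)
      (_ : ChartedSpace (EuclideanSpace ℝ (Fin n) × (EuclideanSpace ℝ (Fin n) →L[ℝ] ℝ)) M)
      (_ : IsManifold 𝓘(ℝ, EuclideanSpace ℝ (Fin n) × (EuclideanSpace ℝ (Fin n) →L[ℝ] ℝ)) ∞ M)
      (_ : T2Space M) (_ : CompactSpace M)
      (σ : TwoForm 𝓘(ℝ, EuclideanSpace ℝ (Fin n) × (EuclideanSpace ℝ (Fin n) →L[ℝ] ℝ)) M)
      (D : Distribution (EuclideanSpace ℝ (Fin n) × (EuclideanSpace ℝ (Fin n) →L[ℝ] ℝ)) M)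
      (q : CotangentBundle (EuclideanSpace ℝ (Fin n)) L → M),
      IsSymplectic σ ∧ IsFoliation n D ∧ IsLagrangian σ D ∧
      IsLeaf (E := EuclideanSpace ℝ (Fin n)) D (fun x : L => q ⟨x, 0⟩) ∧
      IsWeinsteinConnection (E := EuclideanSpace ℝ (Fin n)) σ D (fun x : L => q ⟨x, 0⟩) ∧
      IsCotangentQuotient (cotangentLattice b) σ D q := by
  obtain ⟨M, _, _, _, hT2, hcompact, h⟩ := proposition2p4_general n _ L x₀ b hb
  exact ⟨M, _, _, inferInstance, hT2 inferInstance, hcompact inferInstance, h⟩
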